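/- \textbf{Setting.} An $n$-mode (zero-mean) Gaussian state is given by its covariance matrix: a real symmetric positive definite $2n\times 2n$ matrix $\sigma$ with $\sigma+i\Omega\ge 0$, where in the ordering $(x_1,\dots,x_n,p_1,\dots,p_n)$ of the quadratures $\Omega=\begin{bmatrix}0&\mathbb 1\\-\mathbb 1&0\end{bmatrix}$; the vacuum is $\mathbb 1$. It is pure if moreover $\det\sigma=1$. Let $\lambda_1^\uparrow\le\lambda_2^\uparrow\le\cdots$ denote the ordered eigenvalues. For a pure state $\pi$ put $\mathcal S(\pi)=-\frac12\sum_{i=1}^n\ln\lambda_i^\uparrow(\pi)$. The squeezing of formation (SoF) is $$\mathcal S(\sigma)=\inf\{\mathcal S(\pi)\mid \sigma=\pi+\varphi,\ \pi\text{ pure},\ \varphi\ge 0\}.$$ For two modes put $$h(x)=\tfrac{(1+x)^2}{4x}\log_2\tfrac{(1+x)^2}{4x}-\tfrac{(1-x)^2}{4x}\log_2\tfrac{(1-x)^2}{4x}\qquad(0\log_2 0=0).$$ For a pure two-mode $\pi$ let $\nu_-(\pi^\Gamma)$ be the smallest symplectic eigenvalue (least modulus of an eigenvalue of $i\Omega\pi^\Gamma$)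 of the partial transpose $\pi^\Gamma$ (sign change of $p_2$), and $\mathcal E(\pi)=h(\nu_-(\pi^\Gamma))$ if $\nu_-(\pi^\Gamma)<1$, $\mathcal E(\pi)=0$ otherwise. The entanglement of formation (EoF) of a two-mode Gaussian state is $$\mathcal E(\sigma)=\inf\{\mathcal E(\pi)\mid\sigma=\pi+\varphi,\ \pi\text{ pure},\ \varphi\ge 0\},$$ and its EoF-potential is $$\mathcal P(\sigma)=\sup\{\mathcal E(\mathrm{tr}_n[K(\sigma\oplus\mathbb 1_n)K^T])\mid n\ge 0,\ K \text{ passive}\},$$ where $\mathbb 1_n$ is the vacuum of $n$ ancillary modes, $K$ runs over the orthogonal symplectic matrices on $n+2$ modes, and $\mathrm{tr}_n$ discards the $n$ ancillary modes. Let $B_{ij}(\theta)$ be the beam splitter $q_i\mapsto\cos\theta\,q_i+\sin\theta\,q_j$, $q_j\mapsto-\sin\theta\,q_i+\cos\theta\,q_j$ of the modes $i,j$ (for both $q=x$ and $q=p$). \textbf{Theorem.} Let $a,c_1,c_2\in\mathbb R$ be such that, in the ordering $(x_1,x_2,p_1,p_2)$, $$\sigma=\begin{bmatrix}a&c_1\\c_1&a\end{bmatrix}\oplus\begin{bmatrix}a&c_2\\c_2&a\end{bmatrix}$$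 is the covariance matrix of a Gaussian state (a symmetric state). Put $\mu_\pm=\min\{1,\sqrt{a\pm c_1},\sqrt{a\pm c_2}\}$ and let $\lambda_1^\uparrow\le\lambda_2^\uparrow$ be the two smallest eigenvalues of $\sigma$. Then: (i) $\mathcal S(\sigma)=-\ln(\mu_+\mu_-)$. (ii) $\mathcal P(\sigma)=h(\mu_+\mu_-)$; in particular the supremum is finite. (iii) $\mathcal E(\sigma)=h\big(\sqrt{\lambda_1^\uparrow\lambda_2^\uparrow}\big)$ if $\lambda_1^\uparrow\lambda_2^\uparrow<1$, and $\mathcal E(\sigma)=0$ otherwise. (iv) If $\sigma$ is classical ($\lambda_1^\uparrow\ge 1$) or $\lambda_2^\uparrow\le 1$, then $\mathcal E(\sigma)=h(\mu_+\mu_-)$. If $\lambda_1^\uparrow<1<\lambda_2^\uparrow$, then $\mathcal E(\sigma)<h(\mu_+\mu_-)$. (v) For $k\in\{1,2\}$ the matrix $K_k=B_{12}(\pi/4)\,B_{k3}(\pi/2)\,B_{12}(\pi/4)$ on three modes is passive. If $\lambda_1^\uparrow<1\le\lambda_2^\uparrow$, then either $a-c_1\ge1$ and $a-c_2\ge 1$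 (the second mode after the first beam splitter is unsqueezed) and $\mathcal E(\mathrm{tr}_3[K_2(\sigma\oplus\mathbb 1)K_2^T])=h(\mu_+\mu_-)$, or $a+c_1\ge1$ and $a+c_2\ge 1$ (the first one is unsqueezed) and $\mathcal E(\mathrm{tr}_3[K_1(\sigma\oplus\mathbb 1)K_1^T])=h(\mu_+\mu_-)$. Thus one vacuum ancilla, swapped with the unsqueezed mode, attains the EoF-potential. -/

import Mathlib

/-! Gaussian states of finitely many bosonic modes, described by covariance matrices.
A system with mode set `ι` has quadratures indexed by `ι ⊕ ι`: `Sum.inl i` is the position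
`x i` and `Sum.inr i` is the momentum `p i`. The vacuum has covariance matrix `1`. -/

noncomputable section

namespace GaussianEoF

open Matrix

open scoped ComplexOrder

/-- Real matrices indexed by the quadratures of the modes `ι`. -/
abbrev QuadMatrix (ι : Type) : Type := Matrix (ι ⊕ ι) (ι ⊕ ι) ℝ

section General

variable {ι : Type} [Fintype ι] [DecidableEq ι]

/-- The symplectic form, `Ω = [[0, 1], [-1, 0]]` in the ordering `(x, p)`. -/
def symplecticForm (ι : Type) [DecidableEq ι] : QuadMatrix ι :=
  Matrix.fromBlocks 0 1 (-1) 0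

/-- `V` is the covariance matrix of a Gaussian state: a real symmetric positive definite matrix
obeying the uncertainty relation `V + i Ω ≥ 0`. -/
def IsCovariance (V : QuadMatrix ι) : Prop :=
  V.PosDef ∧
    (V.map Complex.ofReal + Complex.I • (symplecticForm ι).map Complex.ofReal).PosSemidef

/-- `V` is the covariance matrix of a pure Gaussian state. -/
def IsPure (V : QuadMatrix ι) : Prop :=
  IsCovariance V ∧ V.det = 1

/-- The pure covariance matrices `π` with `V = π + φ` for some noise matrix `φ ≥ 0`. -/
def pureDecompositions (V : QuadMatrix ι) : Set (QuadMatrix ι) :=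
  {P | IsPure P ∧ ∃ N : QuadMatrix ι, N.PosSemidef ∧ V = P + N}

/-- The eigenvalues of a real symmetric matrix with multiplicity, listed in increasing order;
`eigUp V 0` is the smallest one, `eigUp V 1` the next one, and so on. -/
def eigUp (V : QuadMatrix ι) (k : ℕ) : ℝ :=
  (V.charpoly.roots.sort (· ≤ ·)).getD k 0

/-- The squeezing `-(1/2) ∑ ln λ` of a pure state of `n` modes, the sum running over the
`n` smallest of the `2 n` eigenvalues of its covariance matrix. -/
def pureSqueezing (P : QuadMatrix ι) : ℝ :=
  -(1 / 2) * ∑ k ∈ Finset.range (Fintype.card ι), Real.log (eigUp P k)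

/-- The squeezing values over which the squeezing of formation takes the infimum. -/
def squeezingValues (V : QuadMatrix ι) : Set ℝ :=
  pureSqueezing '' pureDecompositions V

/-- Squeezing of formation. -/
def sof (V : QuadMatrix ι) : ℝ := sInf (squeezingValues V)

/-- The smallest symplectic eigenvalue of `V`: the least modulus of an eigenvalue of `i Ω V`. -/
def minSymplecticEigenvalue (V : QuadMatrix ι) : ℝ :=
  sInf ((fun z : ℂ => ‖z‖) ''
    spectrum ℂ (Complex.I • (symplecticForm ι * V).map Complex.ofReal))

/-- Passive operations: symplectic and orthogonal. -/
def IsPassive (K : QuadMatrix ι) : Prop :=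
  K * symplecticForm ι * Kᵀ = symplecticForm ι ∧ K * Kᵀ = 1

/-- The state `V` together with ancillary vacuum modes `κ`. -/
def addVacuum (κ : Type) [DecidableEq κ] (V : QuadMatrix ι) : QuadMatrix (ι ⊕ κ) :=
  Matrix.fromBlocks
    (Matrix.fromBlocks V.toBlocks₁₁ 0 0 1) (Matrix.fromBlocks V.toBlocks₁₂ 0 0 0)
    (Matrix.fromBlocks V.toBlocks₂₁ 0 0 0) (Matrix.fromBlocks V.toBlocks₂₂ 0 0 1)

/-- The reduced state of the modes `ι`, after tracing out the modes `κ`. -/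
def traceOut {κ : Type} (V : QuadMatrix (ι ⊕ κ)) : QuadMatrix ι :=
  V.submatrix (Sum.map Sum.inl Sum.inl) (Sum.map Sum.inl Sum.inl)

/-- The action of the beam splitter `B(θ) = exp[θ(a† b - a b†)]` of modes `i` and `j` on positions
(and likewise on momenta): `qᵢ ↦ cos θ qᵢ + sin θ qⱼ`, `qⱼ ↦ -sin θ qᵢ + cos θ qⱼ`. -/
def modeRotation (i j : ι) (θ : ℝ) : Matrix ι ι ℝ :=
  Matrix.of fun k l =>
    if (k = i ∧ l = i) ∨ (k = j ∧ l = j) then Real.cos θ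
    else if k = i ∧ l = j then Real.sin θ
    else if k = j ∧ l = i then -Real.sin θ
    else if k = l then 1 else 0

/-- The symplectic matrix of the beam splitter `B(θ)` of the modes `i` and `j`. -/
def beamSplitter (i j : ι) (θ : ℝ) : QuadMatrix ι :=
  Matrix.fromBlocks (modeRotation i j θ) 0 0 (modeRotation i j θ)

end General

/-- The auxiliary function `h` (with `0 log 0 = 0`). -/
def h (x : ℝ) : ℝ :=
  (1 + x) ^ 2 / (4 * x) * Real.logb 2 ((1 + x) ^ 2 / (4 * x)) -
    (1 - x) ^ 2 / (4 * x) * Real.logb 2 ((1 - x) ^ 2 / (4 * x))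

/-- Partial transposition of a two-mode state: the momentum of the second mode changes sign. -/
def partialTranspose (V : QuadMatrix (Fin 2)) : QuadMatrix (Fin 2) :=
  let T : QuadMatrix (Fin 2) := Matrix.diagonal (Sum.elim ![1, 1] ![1, -1])
  T * V * T

open Classical in
/-- The entropy of entanglement of a pure two-mode state. -/
def pureEntanglement (P : QuadMatrix (Fin 2)) : ℝ :=
  if minSymplecticEigenvalue (partialTranspose P) < 1 then
    h (minSymplecticEigenvalue (partialTranspose P))
  else 0

/-- Entanglement of formation of a two-mode Gaussian state. -/
def eof (V : QuadMatrix (Fin 2)) : ℝ := sInf (pureEntanglement '' pureDecompositions V)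

/-- The two-mode state obtained by adding `n` vacuum modes, applying `K` and discarding the last
`n` modes. -/
def passiveOutput {n : ℕ} (K : QuadMatrix (Fin 2 ⊕ Fin n)) (V : QuadMatrix (Fin 2)) :
    QuadMatrix (Fin 2) :=
  traceOut (K * addVacuum (Fin n) V * Kᵀ)

/-- The entanglements of formation attainable from `V` by passive operations and any number of
ancillary vacuum modes. -/
def attainableEof (V : QuadMatrix (Fin 2)) : Set ℝ :=
  {e | ∃ (n : ℕ) (K : QuadMatrix (Fin 2 ⊕ Fin n)), IsPassive K ∧ e = eof (passiveOutput K V)}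

/-- EoF-potential of a two-mode Gaussian state. -/
def eofPotential (V : QuadMatrix (Fin 2)) : ℝ := sSup (attainableEof V)

/-- The matrix `[[a, c₁], [c₁, a]] ⊕ [[a, c₂], [c₂, a]]` in the ordering `(x₁, x₂, p₁, p₂)`. -/
def symmetricState (a c₁ c₂ : ℝ) : QuadMatrix (Fin 2) :=
  Matrix.fromBlocks !![a, c₁; c₁, a] 0 0 !![a, c₂; c₂, a]

/-- `μ₊ = min {1, √(a + c₁), √(a + c₂)}`. -/
def muPlus (a c₁ c₂ : ℝ) : ℝ := min 1 (min (Real.sqrt (a + c₁)) (Real.sqrt (a + c₂)))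

/-- `μ₋ = min {1, √(a - c₁), √(a - c₂)}`. -/
def muMinus (a c₁ c₂ : ℝ) : ℝ := min 1 (min (Real.sqrt (a - c₁)) (Real.sqrt (a - c₂)))

/-- A balanced beam splitter of the two input modes, then a swap of the input mode `k` with the
single ancillary mode (a beam splitter with angle `π / 2`), then again the balanced one. -/
def swapNetwork (k : Fin 2) : QuadMatrix (Fin 2 ⊕ Fin 1) :=
  beamSplitter (Sum.inl 0) (Sum.inl 1) (Real.pi / 4) *
    beamSplitter (Sum.inl k) (Sum.inr 0) (Real.pi / 2) *
    beamSplitter (Sum.inl 0) (Sum.inl 1) (Real.pi / 4)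

end GaussianEoF

end

/-!
A symmetric state is the image under a balanced beam splitter of a product of two single-mode
states, with position variances `p = a + c₁`, `q = a - c₁` and momentum variances `r = a + c₂`,
`s = a - c₂`; this is `mixedProduct p q r s`. Its eigenvalues are `p, q, r, s`, the uncertainty
relation says that `p r ≥ 1` and `q s ≥ 1`, and partial transposition exchanges `r` and `s`. Also
`m² = min {1, p, r} · min {1, q, s}`.

*Squeezing of formation.* For a pure two-mode state the product of the two smallest eigenvalues is
at most `1`, at most every Rayleigh quotient, and at most the Gram determinant of any orthonormal
pair (`eigUp_mul_le`). Evaluated on the eigenvectors of a symmetric state above it, this bounds the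
product by `m²` (`eigUp_mul_le_of_mem`). Equality holds for a pure product state behind the beam
splitter that reduces the noise of each mode separately (`exists_pure_variances`).

*Upper bound on the potential.* Let `P` be this optimal pure state, together with the vacuum modes
and after the passive operation: `P = O D Oᵀ` with `D` diagonal, and the products of two distinct
entries of `D` are at least `m²`. The ancillas are projected onto the vacuum instead of being
discarded: `P ↦ (P + 1)⁻¹` turns this into a compression of matrices, the result `P'` is pure, lies
below the partial trace of `P`, and above a compression `Wᵀ P W` with `Vᵀ W = 1`, where `V` is the
inclusion of the remaining modes (`exists_symplectic_compression`). For an antisymmetric contraction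
`A` one has `D + i m A ≥ 0` by Lagrange's identity (`dominates_diagonal`). Compressed by `W` and
partially transposed, this gives `P'^Γ + i m Ω ≥ 0`, that is, `ν₋(P'^Γ) ≥ m`
(`exists_mem_pureDecompositions_passiveOutput`), and `h` is decreasing on `(0, 1]`.

*Lower bounds.* The smallest symplectic eigenvalue is the largest `t` with `V + i t Ω ≥ 0`, so it
is monotone in `V`. Hence the partial transpose of a symmetric state bounds the entanglement of
all its pure components (`le_eof_mixedProduct`), and explicit components attain this bound: this
computes the entanglement of formation (`eof_mixedProduct_of_lt`, `eof_mixedProduct_eq_zero`). It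
also shows that the potential is attained. If no mode is squeezed, or if the two smallest
eigenvalues are at most `1`, the state itself attains it. Otherwise one mode is unsqueezed, and
the swap network replaces it by the vacuum, which leads to `mixedProduct 1 p 1 r` or `mixedProduct
q 1 s 1` (`exists_eof_swapNetwork`).
-/

noncomputable section

namespace GaussianEoF

open Matrix

open scoped ComplexOrder

/-! ### The function `h` -/

lemma strictMonoOn_mul_log_sub :
    StrictMonoOn (fun u : ℝ => u * Real.log u - (u - 1) * Real.log (u - 1)) (Set.Ici 1) := by
  refine strictMonoOn_of_deriv_pos (convex_Ici 1) ?_ ?_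
  · have h1 := Real.continuous_mul_log
    exact (h1.sub (h1.comp (continuous_id.sub continuous_const))).continuousOn
  · intro u hu
    rw [interior_Ici] at hu
    have hu1 : (1 : ℝ) < u := hu
    have h1 := Real.hasDerivAt_mul_log (x := u) (by linarith)
    have h2 := (Real.hasDerivAt_mul_log (x := u - 1) (by linarith)).comp u
      ((hasDerivAt_id u).sub_const 1)
    have h3 := h1.sub h2
    have h4 : deriv (fun u : ℝ => u * Real.log u - (u - 1) * Real.log (u - 1)) u =
        Real.log u + 1 - (Real.log (u - 1) + 1) * 1 := h3.deriv
    rw [h4]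
    have := Real.log_lt_log (show 0 < u - 1 by linarith) (show u - 1 < u by linarith)
    linarith

lemma h_strictAntiOn : StrictAntiOn h (Set.Ioc 0 1) := by
  -- `h x` is `u log₂ u - (u - 1) log₂ (u - 1)` at `u = (1 + x)² / (4 x) ≥ 1`.
  have key : ∀ x : ℝ, 0 < x → h x = ((fun u : ℝ => u * Real.log u - (u - 1) * Real.log (u - 1))
      ((1 + x) ^ 2 / (4 * x))) / Real.log 2 := by
    intro x hx
    have h1 : (1 - x) ^ 2 / (4 * x) = (1 + x) ^ 2 / (4 * x) - 1 := by
      field_simp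
      ring
    simp only [h, Real.logb, h1]
    ring
  intro x hx y hy hxy
  rw [key x hx.1, key y hy.1]
  have hge : ∀ z : ℝ, 0 < z → 1 ≤ (1 + z) ^ 2 / (4 * z) := by
    intro z hz
    rw [le_div_iff₀ (by linarith)]
    nlinarith [sq_nonneg (1 - z)]
  have hlt : (1 + y) ^ 2 / (4 * y) < (1 + x) ^ 2 / (4 * x) := by
    have hx0 := hx.1
    have hy0 := hy.1
    have hxy1 : x * y < 1 := by nlinarith [hx.2, hy.2]
    rw [div_lt_div_iff₀ (by linarith) (by linarith)]
    nlinarith [mul_pos (sub_pos.2 hxy) (sub_pos.2 hxy1)]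
  exact div_lt_div_of_pos_right (strictMonoOn_mul_log_sub (hge y hy.1) (hge x hx.1) hlt)
    (Real.log_pos (by norm_num))

lemma h_one : h 1 = 0 := by
  norm_num [h]

lemma h_nonneg {x : ℝ} (h0 : 0 < x) (h1 : x ≤ 1) : 0 ≤ h x := by
  rw [← h_one]
  exact h_strictAntiOn.antitoneOn ⟨h0, h1⟩ ⟨one_pos, le_rfl⟩ h1

lemma h_le_h {x y : ℝ} (h0 : 0 < x) (hxy : x ≤ y) (h1 : y ≤ 1) : h y ≤ h x :=
  h_strictAntiOn.antitoneOn ⟨h0, hxy.trans h1⟩ ⟨h0.trans_le hxy, h1⟩ hxy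

/-! ### Positivity of `S + i A` in real terms -/

section Dominates

variable {m n : Type*} [Fintype m] [Fintype n]

/-- The real form of `S + i A ≥ 0`, for `S` symmetric and `A` antisymmetric: evaluated at `x + i y`
the Hermitian form of `S + i A` is `xᵀ S x + yᵀ S y - 2 xᵀ A y`. -/
def Dominates (S A : Matrix n n ℝ) : Prop :=
  ∀ x y : n → ℝ, 0 ≤ x ⬝ᵥ S *ᵥ x + y ⬝ᵥ S *ᵥ y - 2 * (x ⬝ᵥ A *ᵥ y)

lemma dotProduct_mulVec_of_transpose (A : Matrix m n ℝ) (x : m → ℝ) (y : n → ℝ) :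
    x ⬝ᵥ A *ᵥ y = (Aᵀ *ᵥ x) ⬝ᵥ y := by
  rw [dotProduct_mulVec, mulVec_transpose]

lemma dotProduct_mulVec_comm_of_symm {S : Matrix n n ℝ} (hS : Sᵀ = S) (x y : n → ℝ) :
    x ⬝ᵥ S *ᵥ y = y ⬝ᵥ S *ᵥ x := by
  rw [dotProduct_mulVec_of_transpose, hS, dotProduct_comm]

lemma dotProduct_mulVec_antisymm {A : Matrix n n ℝ} (hA : Aᵀ = -A) (x y : n → ℝ) :
    x ⬝ᵥ A *ᵥ y = -(y ⬝ᵥ A *ᵥ x) := by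
  rw [dotProduct_mulVec_of_transpose, hA, neg_mulVec, neg_dotProduct, dotProduct_comm]

lemma dotProduct_mulVec_self_of_antisymm {A : Matrix n n ℝ} (hA : Aᵀ = -A) (x : n → ℝ) :
    x ⬝ᵥ A *ᵥ x = 0 := by
  have := dotProduct_mulVec_antisymm hA x x
  linarith

lemma dotProduct_self_nonneg' (x : n → ℝ) : 0 ≤ x ⬝ᵥ x :=
  Finset.sum_nonneg fun i _ => mul_self_nonneg (x i)

lemma posSemidef_real_iff {S : Matrix n n ℝ} :
    S.PosSemidef ↔ Sᵀ = S ∧ ∀ x, 0 ≤ x ⬝ᵥ S *ᵥ x := by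
  rw [posSemidef_iff_dotProduct_mulVec]
  simp [IsHermitian, conjTranspose_eq_transpose_of_trivial]

lemma posDef_real_iff {S : Matrix n n ℝ} :
    S.PosDef ↔ Sᵀ = S ∧ ∀ x, x ≠ 0 → 0 < x ⬝ᵥ S *ᵥ x := by
  rw [posDef_iff_dotProduct_mulVec]
  simp [IsHermitian, conjTranspose_eq_transpose_of_trivial]

omit [Fintype n] in
lemma isHermitian_add_I_smul {S A : Matrix n n ℝ} (hS : Sᵀ = S) (hA : Aᵀ = -A) :
    (S.map Complex.ofReal + Complex.I • A.map Complex.ofReal).IsHermitian := by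
  ext i j
  have h1 : S j i = S i j := congrFun (congrFun hS i) j
  have h2 : A j i = -A i j := congrFun (congrFun hA i) j
  simp [conjTranspose_apply, h1, h2]

/-- The Hermitian form of `S + i A` at a complex vector with real and imaginary parts `x`, `y`. -/
lemma star_dotProduct_add_I_smul {S A : Matrix n n ℝ} (hS : Sᵀ = S) (hA : Aᵀ = -A)
    (v : n → ℂ) (x y : n → ℝ) (hv : ∀ i, v i = x i + Complex.I * y i) :
    star v ⬝ᵥ (S.map Complex.ofReal + Complex.I • A.map Complex.ofReal) *ᵥ v =
      ((x ⬝ᵥ S *ᵥ x + y ⬝ᵥ S *ᵥ y - 2 * (x ⬝ᵥ A *ᵥ y) : ℝ) : ℂ) := by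
  have e1 := dotProduct_mulVec_comm_of_symm hS x y
  have e2 := dotProduct_mulVec_antisymm hA x y
  have e3 := dotProduct_mulVec_self_of_antisymm hA x
  have e4 := dotProduct_mulVec_self_of_antisymm hA y
  have ofReal_form : ∀ (M : Matrix n n ℝ) (a b : n → ℝ),
      ((a ⬝ᵥ M *ᵥ b : ℝ) : ℂ) = ∑ i, ∑ j, (a i : ℂ) * M i j * b j := by
    intro M a b
    simp [dotProduct, mulVec, Finset.mul_sum, mul_assoc]
  have main : star v ⬝ᵥ (S.map Complex.ofReal + Complex.I • A.map Complex.ofReal) *ᵥ v =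
      ((x ⬝ᵥ S *ᵥ x : ℝ) : ℂ) + ((y ⬝ᵥ S *ᵥ y : ℝ) : ℂ) +
      Complex.I * (((x ⬝ᵥ S *ᵥ y : ℝ) : ℂ) - ((y ⬝ᵥ S *ᵥ x : ℝ) : ℂ)) +
      (Complex.I * (((x ⬝ᵥ A *ᵥ x : ℝ) : ℂ) + ((y ⬝ᵥ A *ᵥ y : ℝ) : ℂ)) -
      ((x ⬝ᵥ A *ᵥ y : ℝ) : ℂ) + ((y ⬝ᵥ A *ᵥ x : ℝ) : ℂ)) := by
    have expand : ∀ M : Matrix n n ℂ, star v ⬝ᵥ M *ᵥ v = ∑ i, ∑ j, star (v i) * M i j * v j := by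
      intro M
      simp [dotProduct, mulVec, Finset.mul_sum, mul_assoc]
    rw [expand]
    simp only [ofReal_form, Finset.mul_sum, ← Finset.sum_add_distrib, ← Finset.sum_sub_distrib]
    refine Finset.sum_congr rfl fun i _ => Finset.sum_congr rfl fun j _ => ?_
    simp only [hv, star_add, star_mul', RCLike.star_def, Complex.conj_ofReal,
      Complex.conj_I, Matrix.add_apply, map_apply, Matrix.smul_apply, smul_eq_mul]
    linear_combination (-(y i : ℂ) * S i j * y j + x i * A i j * y j - y i * A i j * x j
      - Complex.I * y i * A i j * y j) * Complex.I_mul_I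
  rw [main, e1, e3, e4, e2]
  push_cast
  ring

lemma posSemidef_add_I_smul_iff {S A : Matrix n n ℝ} (hS : Sᵀ = S) (hA : Aᵀ = -A) :
    (S.map Complex.ofReal + Complex.I • A.map Complex.ofReal).PosSemidef ↔ Dominates S A := by
  rw [posSemidef_iff_dotProduct_mulVec]
  constructor
  · rintro ⟨-, h⟩ x y
    have := h fun i => x i + Complex.I * y i
    rw [star_dotProduct_add_I_smul hS hA _ x y fun i => rfl] at this
    exact_mod_cast this
  · intro h
    refine ⟨isHermitian_add_I_smul hS hA, fun v => ?_⟩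
    rw [star_dotProduct_add_I_smul hS hA v (fun i => (v i).re) (fun i => (v i).im)
      fun i => by rw [mul_comm]; exact (Complex.re_add_im (v i)).symm]
    exact_mod_cast h _ _

lemma Dominates.mono {S S' A : Matrix n n ℝ} (h : Dominates S A) (hS : (S' - S).PosSemidef) :
    Dominates S' A := by
  intro x y
  have h1 := (posSemidef_real_iff.1 hS).2 x
  have h2 := (posSemidef_real_iff.1 hS).2 y
  have h3 := h x y
  simp only [sub_mulVec, dotProduct_sub] at h1 h2
  linarith

lemma Dominates.conj {S A : Matrix n n ℝ} (h : Dominates S A) (W : Matrix n m ℝ) :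
    Dominates (Wᵀ * S * W) (Wᵀ * A * W) := by
  intro x y
  have e : ∀ (M : Matrix n n ℝ) (a b : m → ℝ),
      a ⬝ᵥ (Wᵀ * M * W) *ᵥ b = (W *ᵥ a) ⬝ᵥ M *ᵥ (W *ᵥ b) := by
    intro M a b
    rw [← mulVec_mulVec, ← mulVec_mulVec, dotProduct_mulVec_of_transpose, transpose_transpose]
  rw [e, e, e]
  exact h _ _

/-- Replacing `y` by `c y` and optimizing over `c`: `S + i A ≥ 0` bounds the entries of `A`. -/
lemma Dominates.sq_le {S A : Matrix n n ℝ} (h : Dominates S A) (x y : n → ℝ)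
    (hy : 0 < y ⬝ᵥ S *ᵥ y) :
    (x ⬝ᵥ A *ᵥ y) ^ 2 ≤ (x ⬝ᵥ S *ᵥ x) * (y ⬝ᵥ S *ᵥ y) := by
  have h1 := h ((y ⬝ᵥ S *ᵥ y) • x) ((x ⬝ᵥ A *ᵥ y) • y)
  simp only [mulVec_smul, smul_dotProduct, dotProduct_smul, smul_eq_mul] at h1
  by_contra hc
  push Not at hc
  nlinarith [mul_pos hy (sub_pos.2 hc)]

end Dominates

/-! ### Antisymmetric contractions below a diagonal matrix -/

section Diagonal

variable {n : Type*} [Fintype n]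

/-- Lagrange's identity with weights. -/
lemma weighted_lagrange_identity (d x y : n → ℝ) :
    2 * ((∑ i, d i * x i ^ 2) * (∑ i, d i * y i ^ 2) - (∑ i, d i * x i * y i) ^ 2) =
      ∑ i, ∑ j, d i * d j * (x i * y j - x j * y i) ^ 2 := by
  have e1 : (∑ i, d i * x i ^ 2) * (∑ i, d i * y i ^ 2) =
      ∑ i, ∑ j, (d i * x i ^ 2) * (d j * y j ^ 2) := Finset.sum_mul_sum _ _ _ _
  have e2 : (∑ i, d i * x i ^ 2) * (∑ i, d i * y i ^ 2) =
      ∑ i, ∑ j, (d j * x j ^ 2) * (d i * y i ^ 2) := by rw [e1, Finset.sum_comm]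
  have e3 : (∑ i, d i * x i * y i) ^ 2 =
      ∑ i, ∑ j, (d i * x i * y i) * (d j * x j * y j) := by rw [sq, Finset.sum_mul_sum]
  rw [mul_sub, two_mul, e3]
  nth_rewrite 1 [e1]
  rw [e2, Finset.mul_sum, ← Finset.sum_add_distrib, ← Finset.sum_sub_distrib]
  refine Finset.sum_congr rfl fun i _ => ?_
  rw [Finset.mul_sum, ← Finset.sum_add_distrib, ← Finset.sum_sub_distrib]
  refine Finset.sum_congr rfl fun j _ => ?_
  ring

/-- If the products of two distinct weights are at least `r`, then the weighted Gram determinant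
of two vectors is at least `r` times the unweighted one. -/
lemma mul_gram_le_weighted_gram {d : n → ℝ} {r : ℝ} (hd : ∀ i j, i ≠ j → r ≤ d i * d j)
    (x y : n → ℝ) :
    r * ((x ⬝ᵥ x) * (y ⬝ᵥ y) - (x ⬝ᵥ y) ^ 2) ≤
      (∑ i, d i * x i ^ 2) * (∑ i, d i * y i ^ 2) - (∑ i, d i * x i * y i) ^ 2 := by
  have h1 := weighted_lagrange_identity d x y
  have h2 := weighted_lagrange_identity (fun _ => (1 : ℝ)) x y
  have e : ∀ a b : n → ℝ, a ⬝ᵥ b = ∑ i, 1 * a i * b i := by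
    intro a b
    simp [dotProduct]
  have e' : ∀ a : n → ℝ, a ⬝ᵥ a = ∑ i, 1 * a i ^ 2 := by
    intro a
    simp [dotProduct, sq]
  rw [← e, ← e', ← e'] at h2
  have h3 : r * ∑ i, ∑ j, (1 : ℝ) * 1 * (x i * y j - x j * y i) ^ 2 ≤
      ∑ i, ∑ j, d i * d j * (x i * y j - x j * y i) ^ 2 := by
    rw [Finset.mul_sum]
    refine Finset.sum_le_sum fun i _ => ?_
    rw [Finset.mul_sum]
    refine Finset.sum_le_sum fun j _ => ?_
    rcases eq_or_ne i j with rfl | hij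
    · simp
    · nlinarith [mul_le_mul_of_nonneg_right (hd i j hij) (sq_nonneg (x i * y j - x j * y i))]
  rw [← h2, ← h1] at h3
  linarith

/-- As `A y` is orthogonal to `y`, only the component of `x` orthogonal to `y` contributes
to `xᵀ A y`. -/
lemma sq_antisymm_contraction_le_gram {A : Matrix n n ℝ} (hA : Aᵀ = -A)
    (hc : ∀ y, (A *ᵥ y) ⬝ᵥ (A *ᵥ y) ≤ y ⬝ᵥ y) (x y : n → ℝ) :
    (x ⬝ᵥ A *ᵥ y) ^ 2 ≤ (x ⬝ᵥ x) * (y ⬝ᵥ y) - (x ⬝ᵥ y) ^ 2 := by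
  rcases eq_or_ne y 0 with rfl | hy
  · simp
  have hpos : 0 < y ⬝ᵥ y := by
    refine lt_of_le_of_ne (dotProduct_self_nonneg' y) fun h => hy ?_
    exact dotProduct_self_eq_zero.1 h.symm
  set z : n → ℝ := (y ⬝ᵥ y) • x - (x ⬝ᵥ y) • y with hz
  have h1 : z ⬝ᵥ A *ᵥ y = (y ⬝ᵥ y) * (x ⬝ᵥ A *ᵥ y) := by
    rw [hz, sub_dotProduct, smul_dotProduct, smul_dotProduct,
      dotProduct_mulVec_self_of_antisymm hA]
    simp
  have h2 : z ⬝ᵥ z = (y ⬝ᵥ y) * ((x ⬝ᵥ x) * (y ⬝ᵥ y) - (x ⬝ᵥ y) ^ 2) := by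
    simp only [hz, sub_dotProduct, dotProduct_sub, smul_dotProduct, dotProduct_smul, smul_eq_mul]
    rw [dotProduct_comm y x]
    ring
  have h3 : (z ⬝ᵥ A *ᵥ y) ^ 2 ≤ (z ⬝ᵥ z) * ((A *ᵥ y) ⬝ᵥ (A *ᵥ y)) := by
    have := Finset.sum_mul_sq_le_sq_mul_sq Finset.univ z (A *ᵥ y)
    simpa [dotProduct, sq] using this
  have h4 : (z ⬝ᵥ z) * ((A *ᵥ y) ⬝ᵥ (A *ᵥ y)) ≤ (z ⬝ᵥ z) * (y ⬝ᵥ y) :=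
    mul_le_mul_of_nonneg_left (hc y) (dotProduct_self_nonneg' z)
  have h5 := h3.trans h4
  rw [h1, h2] at h5
  have h6 : 0 < (y ⬝ᵥ y) ^ 2 := by positivity
  refine le_of_mul_le_mul_left ?_ h6
  nlinarith

lemma dotProduct_diagonal_mulVec [DecidableEq n] (d x y : n → ℝ) :
    x ⬝ᵥ diagonal d *ᵥ y = ∑ i, d i * x i * y i := by
  simp only [dotProduct, mulVec_diagonal]
  exact Finset.sum_congr rfl fun i _ => by ring

/-- The bound behind the comparison of squeezing and entanglement: if the products of two distinct
diagonal entries are at least `m²`, then `diagonal d + i m A ≥ 0` for every antisymmetric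
contraction `A`. -/
lemma dominates_diagonal [DecidableEq n] {d : n → ℝ} {m : ℝ} (hd0 : ∀ i, 0 ≤ d i)
    (hd : ∀ i j, i ≠ j → m ^ 2 ≤ d i * d j) {A : Matrix n n ℝ} (hA : Aᵀ = -A)
    (hc : ∀ y, (A *ᵥ y) ⬝ᵥ (A *ᵥ y) ≤ y ⬝ᵥ y) :
    Dominates (diagonal d) (m • A) := by
  intro x y
  have h1 := sq_antisymm_contraction_le_gram hA hc x y
  have h2 := mul_gram_le_weighted_gram hd x y
  have e : ∀ a : n → ℝ, a ⬝ᵥ diagonal d *ᵥ a = ∑ i, d i * a i ^ 2 := by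
    intro a
    rw [dotProduct_diagonal_mulVec]
    exact Finset.sum_congr rfl fun i _ => by ring
  rw [e, e, smul_mulVec, dotProduct_smul, smul_eq_mul]
  have hp : ∀ a : n → ℝ, 0 ≤ ∑ i, d i * a i ^ 2 := fun a =>
    Finset.sum_nonneg fun i _ => mul_nonneg (hd0 i) (sq_nonneg _)
  have h3 := mul_le_mul_of_nonneg_left h1 (sq_nonneg m)
  have h4 : (2 * (m * (x ⬝ᵥ A *ᵥ y))) ^ 2 ≤
      ((∑ i, d i * x i ^ 2) + ∑ i, d i * y i ^ 2) ^ 2 := by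
    nlinarith [sq_nonneg ((∑ i, d i * x i ^ 2) - ∑ i, d i * y i ^ 2),
      sq_nonneg (∑ i, d i * x i * y i)]
  have := abs_le_of_sq_le_sq h4 (add_nonneg (hp x) (hp y))
  linarith [le_of_abs_le this]

end Diagonal

/-! ### The smallest symplectic eigenvalue -/

section Symplectic

variable {ι : Type} [Fintype ι] [DecidableEq ι]

omit [Fintype ι] in
lemma symplecticForm_transpose : (symplecticForm ι)ᵀ = -symplecticForm ι := by
  simp [symplecticForm, fromBlocks_transpose, fromBlocks_neg]

lemma symplecticForm_mul_self : symplecticForm ι * symplecticForm ι = -1 := by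
  rw [symplecticForm, fromBlocks_multiply, ← fromBlocks_one, fromBlocks_neg]
  simp

lemma symplecticForm_mul_transpose : symplecticForm ι * (symplecticForm ι)ᵀ = 1 := by
  rw [symplecticForm_transpose, mul_neg, symplecticForm_mul_self, neg_neg]

lemma symplecticForm_transpose_mul : (symplecticForm ι)ᵀ * symplecticForm ι = 1 := by
  rw [symplecticForm_transpose, neg_mul, symplecticForm_mul_self, neg_neg]

lemma isCovariance_iff {V : QuadMatrix ι} :
    IsCovariance V ↔ V.PosDef ∧ Dominates V (symplecticForm ι) :=
  and_congr_right fun hV =>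
    posSemidef_add_I_smul_iff (posDef_real_iff.1 hV).1 symplecticForm_transpose

lemma mem_spectrum_iff_exists_mulVec {n : Type*} [Fintype n] [DecidableEq n] {M : Matrix n n ℂ}
    {z : ℂ} : z ∈ spectrum ℂ M ↔ ∃ v, v ≠ 0 ∧ M *ᵥ v = z • v := by
  rw [spectrum.mem_iff, isUnit_iff_isUnit_det, isUnit_iff_ne_zero, not_not,
    ← exists_mulVec_eq_zero_iff]
  refine exists_congr fun v => and_congr_right fun _ => ?_
  rw [sub_mulVec, sub_eq_zero, Algebra.algebraMap_eq_smul_one, smul_mulVec, one_mulVec, eq_comm]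

lemma bddBelow_norm_image (s : Set ℂ) : BddBelow ((fun z : ℂ => ‖z‖) '' s) :=
  ⟨0, by rintro _ ⟨z, -, rfl⟩; exact norm_nonneg z⟩

lemma ofReal_symplecticForm_mulVec (v : ι ⊕ ι → ℂ) :
    (symplecticForm ι).map Complex.ofReal *ᵥ ((symplecticForm ι).map Complex.ofReal *ᵥ v) =
      -v := by
  have h1 : (symplecticForm ι).map Complex.ofReal * (symplecticForm ι).map Complex.ofReal =
      (symplecticForm ι * symplecticForm ι).map Complex.ofReal :=
    (Matrix.map_mul (f := Complex.ofRealHom)).symm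
  rw [mulVec_mulVec, h1, symplecticForm_mul_self]
  have h2 : (-1 : QuadMatrix ι).map Complex.ofReal = -1 := by
    ext i j
    by_cases hij : i = j <;> simp [hij]
  rw [h2, neg_mulVec, one_mulVec]

lemma map_ofReal_mul {l m n : Type*} [Fintype m] (A : Matrix l m ℝ) (B : Matrix m n ℝ) :
    (A * B).map Complex.ofReal = A.map Complex.ofReal * B.map Complex.ofReal :=
  Matrix.map_mul (f := Complex.ofRealHom)

/-- An eigenvector of `i Ω V` with eigenvalue `z` is an isotropic vector of the pencil
`V - z i Ω`, which gives `t ≤ |z|` as soon as `V ± i t Ω ≥ 0`. -/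
lemma le_norm_of_mem_spectrum {V : QuadMatrix ι} (hV : V.PosDef) {t : ℝ}
    (hd : Dominates V (t • symplecticForm ι)) {z : ℂ}
    (hz : z ∈ spectrum ℂ (Complex.I • (symplecticForm ι * V).map Complex.ofReal)) : t ≤ ‖z‖ := by
  obtain ⟨v, hv0, hv⟩ := mem_spectrum_iff_exists_mulVec.1 hz
  have hVs := (posDef_real_iff.1 hV).1
  have h1 : V.map Complex.ofReal *ᵥ v =
      z • (Complex.I • (symplecticForm ι).map Complex.ofReal) *ᵥ v := by
    have := congrArg (fun u => (symplecticForm ι).map Complex.ofReal *ᵥ u) hv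
    simp only [map_ofReal_mul, smul_mulVec, ← mulVec_mulVec, mulVec_smul,
      ofReal_symplecticForm_mulVec] at this
    rw [smul_mulVec, smul_comm, ← this, smul_smul, Complex.I_mul_I]
    simp
  set x : ι ⊕ ι → ℝ := fun i => (v i).re with hx
  set y : ι ⊕ ι → ℝ := fun i => (v i).im with hy
  have hxy : ∀ i, v i = x i + Complex.I * y i := fun i => by
    rw [mul_comm]; exact (Complex.re_add_im (v i)).symm
  have hp := star_dotProduct_add_I_smul hVs (A := 0) (by simp) v x y hxy
  have hq := star_dotProduct_add_I_smul (S := 0) (by simp)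
    (symplecticForm_transpose (ι := ι)) v x y hxy
  have hz0 : (0 : QuadMatrix ι).map Complex.ofReal = 0 := by ext; simp
  rw [hz0, smul_zero, add_zero] at hp
  rw [hz0, zero_add] at hq
  rw [h1, dotProduct_smul, hq] at hp
  simp only [zero_mulVec, dotProduct_zero, zero_add, zero_sub, mul_zero, sub_zero,
    smul_eq_mul] at hp
  have hn := congrArg norm hp
  rw [norm_mul, Complex.norm_real, Complex.norm_real, Real.norm_eq_abs, Real.norm_eq_abs] at hn
  have hpos : 0 < x ⬝ᵥ V *ᵥ x + y ⬝ᵥ V *ᵥ y := by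
    have hx0 : 0 ≤ x ⬝ᵥ V *ᵥ x := (posSemidef_real_iff.1 hV.posSemidef).2 x
    have hy0 : 0 ≤ y ⬝ᵥ V *ᵥ y := (posSemidef_real_iff.1 hV.posSemidef).2 y
    by_cases h0 : x = 0
    · have : y ≠ 0 := by
        rintro h0'
        refine hv0 (funext fun i => ?_)
        rw [hxy, h0, h0']
        simp
      exact add_pos_of_nonneg_of_pos hx0 ((posDef_real_iff.1 hV).2 y this)
    · exact add_pos_of_pos_of_nonneg ((posDef_real_iff.1 hV).2 x h0) hy0
  rw [abs_of_pos hpos] at hn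
  have d1 := hd x y
  have d2 := hd x (-y)
  simp only [smul_mulVec, mulVec_neg, dotProduct_smul, dotProduct_neg, neg_dotProduct,
    smul_eq_mul, neg_neg] at d1 d2
  have habs : 0 < |-(2 * (x ⬝ᵥ symplecticForm ι *ᵥ y))| := by
    rcases (abs_nonneg (-(2 * (x ⬝ᵥ symplecticForm ι *ᵥ y)))).eq_or_lt with h0 | h0
    · rw [← h0, mul_zero] at hn
      exact absurd hn hpos.ne
    · exact h0
  refine le_of_mul_le_mul_right ?_ habs
  rw [hn]
  rcases abs_cases (-(2 * (x ⬝ᵥ symplecticForm ι *ᵥ y))) with ⟨h0, -⟩ | ⟨h0, -⟩ <;>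
    rw [h0] <;> nlinarith

open scoped MatrixOrder in
lemma exists_transpose_mul_self {n : Type*} [Fintype n] [DecidableEq n] {V : Matrix n n ℝ}
    (hV : V.PosDef) : ∃ B : Matrix n n ℝ, IsUnit B ∧ V = Bᵀ * B := by
  obtain ⟨B, hB⟩ := CStarAlgebra.nonneg_iff_eq_star_mul_self.mp hV.posSemidef.nonneg
  rw [star_eq_conjTranspose, conjTranspose_eq_transpose_of_trivial] at hB
  refine ⟨B, ?_, hB⟩
  have := hV.isUnit
  rw [hB] at this
  exact isUnit_of_mul_isUnit_right this

/-- If `V = Bᵀ B`, an eigenvector of `1 + i t B⁻ᵀ Ω B⁻¹` with eigenvalue `e < 0` yields the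
eigenvalue `t / (e - 1)` of `i Ω V`, of modulus smaller than `t`. -/
lemma dominates_of_le_minSymplecticEigenvalue {V : QuadMatrix ι} (hV : V.PosDef) {t : ℝ}
    (ht : 0 ≤ t) (hle : t ≤ minSymplecticEigenvalue V) :
    Dominates V (t • symplecticForm ι) := by
  obtain ⟨B, hB, hVB⟩ := exists_transpose_mul_self hV
  have hdet : IsUnit B.det := (isUnit_iff_isUnit_det B).1 hB
  have hdet' : IsUnit Bᵀ.det := by rwa [det_transpose]
  set A : QuadMatrix ι := (Bᵀ)⁻¹ * symplecticForm ι * B⁻¹ with hA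
  have hAt : Aᵀ = -A := by
    rw [hA, transpose_mul, transpose_mul, symplecticForm_transpose, transpose_nonsing_inv,
      transpose_nonsing_inv, transpose_transpose]
    simp [Matrix.mul_assoc]
  have hBA : Bᵀ * A * B = symplecticForm ι := by
    rw [hA, ← Matrix.mul_assoc, ← Matrix.mul_assoc, mul_nonsing_inv _ hdet', Matrix.one_mul,
      nonsing_inv_mul_cancel_right _ _ hdet]
  have htA : (t • A)ᵀ = -(t • A) := by rw [transpose_smul, hAt, smul_neg]
  have hN := isHermitian_add_I_smul (transpose_one (n := ι ⊕ ι) (α := ℝ)) htA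
  have key : Dominates 1 (t • A) := by
    rw [← posSemidef_add_I_smul_iff transpose_one htA, hN.posSemidef_iff_eigenvalues_nonneg]
    intro j
    by_contra hneg
    have he : hN.eigenvalues j < 0 := not_le.1 hneg
    set e := hN.eigenvalues j with hedef
    have hu := hN.mulVec_eigenvectorBasis j
    have hu0 : ⇑(hN.eigenvectorBasis j) ≠ 0 := by
      intro h0
      exact hN.eigenvectorBasis.orthonormal.ne_zero j (by ext i; exact congrFun h0 i)
    set u : ι ⊕ ι → ℂ := ⇑(hN.eigenvectorBasis j) with hudef
    have h1c : (1 : QuadMatrix ι).map Complex.ofReal = 1 := by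
      ext i k
      by_cases hik : i = k <;> simp [Matrix.one_apply, hik]
    have hIt : (Complex.I • (t • A).map Complex.ofReal) *ᵥ u = ((e : ℂ) - 1) • u := by
      rw [← hedef, h1c, add_mulVec, one_mulVec] at hu
      rw [sub_smul, one_smul, eq_sub_of_add_eq' hu]
      rfl
    set w : ι ⊕ ι → ℂ := (B⁻¹).map Complex.ofReal *ᵥ u with hw
    have huw : u = B.map Complex.ofReal *ᵥ w := by
      rw [hw, mulVec_mulVec, ← map_ofReal_mul, mul_nonsing_inv _ hdet, h1c, one_mulVec]
    have hw0 : w ≠ 0 := by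
      intro h0
      rw [h0, mulVec_zero] at huw
      exact hu0 huw
    have hΩ : (Complex.I * t) • (symplecticForm ι).map Complex.ofReal *ᵥ w =
        ((e : ℂ) - 1) • V.map Complex.ofReal *ᵥ w := by
      have h2 := congrArg (fun a => (Bᵀ).map Complex.ofReal *ᵥ a) hIt
      have h3 : (t • A).map Complex.ofReal = (t : ℂ) • A.map Complex.ofReal := by
        ext
        simp
      rw [huw, h3] at h2
      simp only [mulVec_smul, mulVec_mulVec, smul_smul, Matrix.smul_mul, Matrix.mul_smul,
        ← map_ofReal_mul] at h2
      rw [← Matrix.mul_assoc, hBA, ← hVB, smul_mulVec] at h2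
      exact h2
    have hmem : ((t / (e - 1) : ℝ) : ℂ) ∈
        spectrum ℂ (Complex.I • (symplecticForm ι * V).map Complex.ofReal) := by
      refine mem_spectrum_iff_exists_mulVec.2 ⟨w, hw0, ?_⟩
      have he1 : (e : ℂ) - 1 ≠ 0 := by
        exact_mod_cast (by linarith : e - 1 < 0).ne
      have h2 := congrArg (fun a => (symplecticForm ι).map Complex.ofReal *ᵥ a) hΩ
      simp only [mulVec_smul, ofReal_symplecticForm_mulVec] at h2
      rw [smul_mulVec, map_ofReal_mul, ← mulVec_mulVec]
      refine smul_right_injective _ he1 ?_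
      simp only
      rw [smul_comm, ← h2, smul_smul, smul_smul, smul_neg, ← neg_smul]
      congr 1
      push_cast
      rw [mul_div_cancel₀ _ he1]
      linear_combination (-(t : ℂ)) * Complex.I_mul_I
    have hle' : minSymplecticEigenvalue V ≤ ‖((t / (e - 1) : ℝ) : ℂ)‖ :=
      csInf_le (bddBelow_norm_image _) ⟨_, hmem, rfl⟩
    have h4 := hle.trans hle'
    rw [Complex.norm_real, Real.norm_eq_abs, abs_div, abs_of_nonneg ht,
      abs_of_neg (show e - 1 < 0 by linarith), le_div_iff₀ (by linarith)] at h4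
    rcases ht.eq_or_lt with h0 | h0
    · -- for `t = 0` the matrix is the identity, which has no negative eigenvalue
      rw [← h0] at hIt
      have h5 : ((e : ℂ) - 1) • u = 0 := by
        rw [← hIt]
        have : ((0 : ℝ) • A).map Complex.ofReal = 0 := by ext; simp
        rw [this, smul_zero, zero_mulVec]
      rcases smul_eq_zero.1 h5 with h6 | h6
      · have : e - 1 = 0 := by exact_mod_cast h6
        linarith
      · exact hu0 h6
    · nlinarith
  have := key.conj B
  rwa [Matrix.mul_one, ← hVB, Matrix.mul_smul, Matrix.smul_mul, hBA] at this

lemma le_minSymplecticEigenvalue [Nonempty ι] {V : QuadMatrix ι} (hV : V.PosDef) {t : ℝ}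
    (hd : Dominates V (t • symplecticForm ι)) : t ≤ minSymplecticEigenvalue V := by
  refine le_csInf ((spectrum.nonempty_of_isAlgClosed_of_finiteDimensional ℂ _).image _) ?_
  rintro _ ⟨z, hz, rfl⟩
  exact le_norm_of_mem_spectrum hV hd hz

lemma minSymplecticEigenvalue_pos [Nonempty ι] {V : QuadMatrix ι} (hV : V.PosDef) :
    0 < minSymplecticEigenvalue V := by
  set M := Complex.I • (symplecticForm ι * V).map Complex.ofReal with hM
  have hne : ((fun z : ℂ => ‖z‖) '' spectrum ℂ M).Nonempty :=
    (spectrum.nonempty_of_isAlgClosed_of_finiteDimensional ℂ _).image _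
  have hfin : ((fun z : ℂ => ‖z‖) '' spectrum ℂ M).Finite := (Matrix.finite_spectrum M).image _
  obtain ⟨z, hz, hzeq⟩ := hne.csInf_mem hfin
  change 0 < sInf ((fun z : ℂ => ‖z‖) '' spectrum ℂ M)
  rw [← hzeq]
  refine norm_pos_iff.2 ?_
  rintro rfl
  obtain ⟨v, hv0, hv⟩ := mem_spectrum_iff_exists_mulVec.1 hz
  have hu : IsUnit (symplecticForm ι * V) :=
    (IsUnit.of_mul_eq_one _ symplecticForm_mul_transpose).mul hV.isUnit
  have hdet : M.det ≠ 0 := by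
    rw [hM, det_smul]
    have h1 : ((symplecticForm ι * V).map Complex.ofReal).det =
        ((symplecticForm ι * V).det : ℂ) := (Complex.ofRealHom.map_det _).symm
    rw [h1]
    refine mul_ne_zero (pow_ne_zero _ Complex.I_ne_zero) ?_
    exact_mod_cast ((isUnit_iff_isUnit_det _).1 hu).ne_zero
  rw [zero_smul] at hv
  exact hdet (exists_mulVec_eq_zero_iff.1 ⟨v, hv0, hv⟩)

end Symplectic

/-! ### Pure states and the compression of a pure state -/

section Pure

variable {ι κ : Type} [Fintype ι] [DecidableEq ι] [Fintype κ] [DecidableEq κ]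

/-- A positive definite symplectic matrix, `P⁻¹ = Ω P Ωᵀ`, is the covariance matrix of a pure
state. -/
lemma isPure_of_symplectic {P : QuadMatrix ι} (hP : P.PosDef)
    (hsymp : symplecticForm ι * P * (symplecticForm ι)ᵀ * P = 1) : IsPure P := by
  refine ⟨isCovariance_iff.2 ⟨hP, fun x y => ?_⟩, ?_⟩
  · have h1 : P * (symplecticForm ι * P * (symplecticForm ι)ᵀ) = 1 := mul_eq_one_comm.1 hsymp
    have h2 : P * symplecticForm ι * P = symplecticForm ι := by
      have := congrArg (· * symplecticForm ι) h1
      simpa only [Matrix.mul_assoc, symplecticForm_transpose_mul, Matrix.mul_one, Matrix.one_mul]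
        using this
    -- Complete the square at `w = P⁻¹ Ω y = Ω P y`.
    set w := symplecticForm ι *ᵥ P *ᵥ y with hw
    have hPw : P *ᵥ w = symplecticForm ι *ᵥ y := by
      rw [hw, mulVec_mulVec, mulVec_mulVec, h2]
    have hPs := (posDef_real_iff.1 hP).1
    have h3 := (posSemidef_real_iff.1 hP.posSemidef).2 (x - w)
    have h4 : w ⬝ᵥ symplecticForm ι *ᵥ y = y ⬝ᵥ P *ᵥ y := by
      rw [dotProduct_mulVec_of_transpose, hw, mulVec_mulVec, mulVec_mulVec,
        symplecticForm_transpose_mul, Matrix.one_mul, dotProduct_comm]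
    have h5 : w ⬝ᵥ P *ᵥ x = x ⬝ᵥ symplecticForm ι *ᵥ y := by
      rw [dotProduct_mulVec_comm_of_symm hPs, hPw]
    rw [mulVec_sub, hPw, sub_dotProduct, dotProduct_sub, dotProduct_sub, h4, h5] at h3
    linarith
  · have h1 := congrArg det hsymp
    rw [det_mul, det_mul, det_mul, det_one] at h1
    have h2 := congrArg det (symplecticForm_mul_transpose (ι := ι))
    rw [det_mul, det_one] at h2
    have h3 : P.det ^ 2 = 1 := by
      linear_combination h1 - P.det ^ 2 * h2
    nlinarith [hP.det_pos]

lemma posSemidef_transpose_mul_mul {m n : Type*} [Fintype m] [Fintype n] {S : Matrix n n ℝ}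
    (hS : S.PosSemidef) (W : Matrix n m ℝ) : (Wᵀ * S * W).PosSemidef := by
  have := hS.conjTranspose_mul_mul_same W
  rwa [conjTranspose_eq_transpose_of_trivial] at this

lemma posDef_transpose_mul_mul {m n : Type*} [Fintype m] [DecidableEq m] [Fintype n]
    {S : Matrix n n ℝ} (hS : S.PosDef) {W : Matrix n m ℝ} {V : Matrix m n ℝ} (hVW : V * W = 1) :
    (Wᵀ * S * W).PosDef := by
  have := hS.conjTranspose_mul_mul_same (B := W) fun x y hxy => by
    have := congrArg (V *ᵥ ·) hxy
    simpa [mulVec_mulVec, hVW] using this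
  rwa [conjTranspose_eq_transpose_of_trivial] at this

/-- The state of the remaining modes after projecting all other modes of a pure state onto the
vacuum. The map `P ↦ (P + 1)⁻¹` turns the partial trace into the compression by the isometry `V`,
and `Ω Q Ωᵀ = 1 - Q` characterizes the images of pure states, so compressing the image of a pure
state `P` yields the image of a pure state `P'`. It lies below the partial trace `Vᵀ P V`, and it
is at least a compression `Wᵀ P W` of `P`, which controls its squeezing. -/
lemma exists_symplectic_compression {V : Matrix (κ ⊕ κ) (ι ⊕ ι) ℝ} (hV : Vᵀ * V = 1)
    (hVΩ : Vᵀ * symplecticForm κ = symplecticForm ι * Vᵀ) {P : QuadMatrix κ} (hP : P.PosDef)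
    (hsymp : symplecticForm κ * P * (symplecticForm κ)ᵀ * P = 1) :
    ∃ (P' : QuadMatrix ι) (W : Matrix (κ ⊕ κ) (ι ⊕ ι) ℝ), IsPure P' ∧
      (Vᵀ * P * V - P').PosSemidef ∧ Vᵀ * W = 1 ∧ (P' - Wᵀ * P * W).PosSemidef := by
  have hP1 : (P + 1).PosDef := hP.add PosDef.one
  have hdet : IsUnit (P + 1).det := (isUnit_iff_isUnit_det _).1 hP1.isUnit
  obtain ⟨Q, hQ⟩ : ∃ Q, Q = (P + 1)⁻¹ := ⟨_, rfl⟩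
  have hQpd : Q.PosDef := hQ ▸ hP1.inv
  have hQ1 : (P + 1) * Q = 1 := by rw [hQ, mul_nonsing_inv _ hdet]
  have hQ2 : Q * (P + 1) = 1 := mul_eq_one_comm.1 hQ1
  have hQs : Qᵀ = Q := (posDef_real_iff.1 hQpd).1
  have hΩQ : symplecticForm κ * Q * (symplecticForm κ)ᵀ = 1 - Q := by
    set T := symplecticForm κ * P * (symplecticForm κ)ᵀ with hT
    have h1 : symplecticForm κ * Q * (symplecticForm κ)ᵀ * (T + 1) = 1 := by
      have : T + 1 = symplecticForm κ * (P + 1) * (symplecticForm κ)ᵀ := by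
        rw [Matrix.mul_add, Matrix.add_mul, Matrix.mul_one, symplecticForm_mul_transpose]
      rw [this]
      calc _ = symplecticForm κ * Q * ((symplecticForm κ)ᵀ * symplecticForm κ) * (P + 1) *
            (symplecticForm κ)ᵀ := by simp only [Matrix.mul_assoc]
        _ = 1 := by
          rw [symplecticForm_transpose_mul, Matrix.mul_one, Matrix.mul_assoc (symplecticForm κ),
            hQ2, Matrix.mul_one, symplecticForm_mul_transpose]
    have h2 : (T + 1) * (P * Q) = 1 := by
      rw [Matrix.add_mul, ← Matrix.mul_assoc, hsymp, Matrix.one_mul, Matrix.one_mul, ← hQ1,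
        Matrix.add_mul, Matrix.one_mul, add_comm]
    have h3 : P * Q = 1 - Q := by
      rw [← hQ1, Matrix.add_mul, Matrix.one_mul, add_sub_cancel_right]
    calc _ = symplecticForm κ * Q * (symplecticForm κ)ᵀ * ((T + 1) * (P * Q)) := by
          rw [h2, Matrix.mul_one]
      _ = 1 - Q := by rw [← Matrix.mul_assoc, h1, Matrix.one_mul, h3]
  have hΩV : (symplecticForm κ)ᵀ * V = V * (symplecticForm ι)ᵀ := by
    simpa [transpose_mul] using congrArg transpose hVΩ
  obtain ⟨Q', hQ'⟩ : ∃ Q', Q' = Vᵀ * Q * V := ⟨_, rfl⟩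
  have hQ'pd : Q'.PosDef := hQ' ▸ posDef_transpose_mul_mul hQpd hV
  have hΩQ' : symplecticForm ι * Q' * (symplecticForm ι)ᵀ = 1 - Q' := by
    calc _ = (symplecticForm ι * Vᵀ) * Q * (V * (symplecticForm ι)ᵀ) := by
          rw [hQ']; simp only [Matrix.mul_assoc]
      _ = Vᵀ * (symplecticForm κ * Q * (symplecticForm κ)ᵀ) * V := by
          rw [← hVΩ, ← hΩV]; simp only [Matrix.mul_assoc]
      _ = 1 - Q' := by rw [hΩQ, Matrix.mul_sub, Matrix.sub_mul, Matrix.mul_one, hV, hQ']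
  have hdet' : IsUnit Q'.det := (isUnit_iff_isUnit_det _).1 hQ'pd.isUnit
  obtain ⟨R, hR⟩ : ∃ R, R = Q'⁻¹ := ⟨_, rfl⟩
  have hR1 : Q' * R = 1 := by rw [hR, mul_nonsing_inv _ hdet']
  have hR2 : R * Q' = 1 := mul_eq_one_comm.1 hR1
  have hRs : Rᵀ = R := (posDef_real_iff.1 (hR ▸ hQ'pd.inv : R.PosDef)).1
  obtain ⟨W, hW⟩ : ∃ W, W = Q * V * R := ⟨_, rfl⟩
  have hVW : Vᵀ * W = 1 := by
    rw [hW, ← Matrix.mul_assoc, ← Matrix.mul_assoc, ← hQ', hR1]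
  have hWV : Wᵀ * V = 1 := by simpa [transpose_mul] using congrArg transpose hVW
  have hPW : (P + 1) * W = V * R := by
    rw [hW, ← Matrix.mul_assoc, ← Matrix.mul_assoc, hQ1, Matrix.one_mul]
  have hWP : Wᵀ * (P + 1) = R * Vᵀ := by
    rw [hW, transpose_mul, transpose_mul, hQs, hRs, Matrix.mul_assoc, Matrix.mul_assoc, hQ2,
      Matrix.mul_one]
  have e1 : Wᵀ * (P + 1) * W = R := by rw [hWP, Matrix.mul_assoc, hVW, Matrix.mul_one]
  have e2 : Wᵀ * (P + 1) * V = R := by rw [hWP, Matrix.mul_assoc, hV, Matrix.mul_one]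
  have e3 : Vᵀ * (P + 1) * W = R := by
    rw [Matrix.mul_assoc, hPW, ← Matrix.mul_assoc, hV, Matrix.one_mul]
  have hge : R - 1 - Wᵀ * P * W = (W - V)ᵀ * (1 : QuadMatrix κ) * (W - V) := by
    have h1 : Wᵀ * P * W = R - Wᵀ * W := by
      rw [← e1, Matrix.mul_add, Matrix.add_mul, Matrix.mul_one, add_sub_cancel_right]
    have h2 : (W - V)ᵀ * (W - V) = Wᵀ * W - 1 - 1 + 1 := by
      rw [transpose_sub, Matrix.sub_mul, Matrix.mul_sub, Matrix.mul_sub, hVW, hWV, hV]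
      abel
    rw [h1, Matrix.mul_one, h2]
    abel
  have hle : Vᵀ * P * V - (R - 1) = (W - V)ᵀ * (P + 1) * (W - V) := by
    rw [transpose_sub, Matrix.sub_mul, Matrix.sub_mul, Matrix.mul_sub, Matrix.mul_sub, e1, e2, e3,
      Matrix.mul_add, Matrix.add_mul, Matrix.mul_one, hV]
    abel
  have hgepsd : (R - 1 - Wᵀ * P * W).PosSemidef := by
    rw [hge]
    exact posSemidef_transpose_mul_mul PosSemidef.one _
  refine ⟨R - 1, W, isPure_of_symplectic ?_ ?_, ?_, hVW, hgepsd⟩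
  · have := (posDef_transpose_mul_mul hP hVW).add_posSemidef hgepsd
    rwa [add_sub_cancel] at this
  · obtain ⟨S, hS⟩ : ∃ S, S = symplecticForm ι * R * (symplecticForm ι)ᵀ := ⟨_, rfl⟩
    have h1 : S * (1 - Q') = 1 := by
      rw [hS, ← hΩQ']
      calc _ = symplecticForm ι * R * ((symplecticForm ι)ᵀ * symplecticForm ι) * Q' *
            (symplecticForm ι)ᵀ := by simp only [Matrix.mul_assoc]
        _ = 1 := by
          rw [symplecticForm_transpose_mul, Matrix.mul_one, Matrix.mul_assoc (symplecticForm ι),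
            hR2, Matrix.mul_one, symplecticForm_mul_transpose]
    have h2 : S * R - S = R := by
      have := congrArg (· * R) h1
      simpa only [Matrix.mul_assoc, Matrix.sub_mul, Matrix.one_mul, hR1, Matrix.mul_sub,
        Matrix.mul_one] using this
    rw [Matrix.mul_sub (symplecticForm ι), Matrix.sub_mul, ← hS, Matrix.mul_one,
      symplecticForm_mul_transpose, Matrix.sub_mul, Matrix.one_mul, Matrix.mul_sub, Matrix.mul_one,
      h2]
    abel
  · rw [hle]
    exact posSemidef_transpose_mul_mul hP1.posSemidef _

end Pure

/-! ### Product states behind a balanced beam splitter -/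

section MixedProduct

/-- Two single-mode states with position variances `p`, `q` and momentum variances `r`, `s`, mixed
by a balanced beam splitter. -/
def mixedProduct (p q r s : ℝ) : QuadMatrix (Fin 2) :=
  fromBlocks !![(p + q) / 2, (p - q) / 2; (p - q) / 2, (p + q) / 2] 0 0
    !![(r + s) / 2, (r - s) / 2; (r - s) / 2, (r + s) / 2]

lemma symmetricState_eq_mixedProduct (a c₁ c₂ : ℝ) :
    symmetricState a c₁ c₂ = mixedProduct (a + c₁) (a - c₁) (a + c₂) (a - c₂) := by
  have e1 : ∀ c, (a + c + (a - c)) / 2 = a := fun c => by ring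
  have e2 : ∀ c, (a + c - (a - c)) / 2 = c := fun c => by ring
  simp only [symmetricState, mixedProduct, e1, e2]

lemma dotProduct_mixedProduct (p q r s : ℝ) (x y : Fin 2 ⊕ Fin 2 → ℝ) :
    x ⬝ᵥ mixedProduct p q r s *ᵥ y =
      p * ((x (.inl 0) + x (.inl 1)) * (y (.inl 0) + y (.inl 1))) / 2 +
      q * ((x (.inl 0) - x (.inl 1)) * (y (.inl 0) - y (.inl 1))) / 2 +
      (r * ((x (.inr 0) + x (.inr 1)) * (y (.inr 0) + y (.inr 1))) / 2 +
      s * ((x (.inr 0) - x (.inr 1)) * (y (.inr 0) - y (.inr 1))) / 2) := by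
  simp [mixedProduct, dotProduct, mulVec, Fintype.sum_sum_type, Fin.sum_univ_two]
  ring

lemma dotProduct_symplecticForm (x y : Fin 2 ⊕ Fin 2 → ℝ) :
    x ⬝ᵥ symplecticForm (Fin 2) *ᵥ y =
      x (.inl 0) * y (.inr 0) + x (.inl 1) * y (.inr 1) -
      x (.inr 0) * y (.inl 0) - x (.inr 1) * y (.inl 1) := by
  simp [symplecticForm, dotProduct, mulVec, Fintype.sum_sum_type, Fin.sum_univ_two, one_apply]
  ring

lemma mixedProduct_transpose (p q r s : ℝ) : (mixedProduct p q r s)ᵀ = mixedProduct p q r s := by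
  ext i j
  rcases i with i | i <;> rcases j with j | j <;> fin_cases i <;> fin_cases j <;>
    simp [mixedProduct]

lemma mixedProduct_sub (p q r s p' q' r' s' : ℝ) :
    mixedProduct p q r s - mixedProduct p' q' r' s' =
      mixedProduct (p - p') (q - q') (r - r') (s - s') := by
  ext i j
  rcases i with i | i <;> rcases j with j | j <;> fin_cases i <;> fin_cases j <;>
    simp [mixedProduct] <;> ring

lemma posSemidef_mixedProduct {p q r s : ℝ} (hp : 0 ≤ p) (hq : 0 ≤ q) (hr : 0 ≤ r) (hs : 0 ≤ s) :
    (mixedProduct p q r s).PosSemidef := by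
  refine posSemidef_real_iff.2 ⟨mixedProduct_transpose _ _ _ _, fun x => ?_⟩
  rw [dotProduct_mixedProduct]
  have := mul_nonneg hp (mul_self_nonneg (x (.inl 0) + x (.inl 1)))
  have := mul_nonneg hq (mul_self_nonneg (x (.inl 0) - x (.inl 1)))
  have := mul_nonneg hr (mul_self_nonneg (x (.inr 0) + x (.inr 1)))
  have := mul_nonneg hs (mul_self_nonneg (x (.inr 0) - x (.inr 1)))
  linarith

lemma pos_of_posDef_mixedProduct {p q r s : ℝ} (h : (mixedProduct p q r s).PosDef) :
    0 < p ∧ 0 < q ∧ 0 < r ∧ 0 < s := by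
  have h1 := fun x => (posDef_real_iff.1 h).2 x
  have hne : ∀ (v : Fin 2 ⊕ Fin 2 → ℝ) (i), v i ≠ 0 → v ≠ 0 := fun v i hv h0 => hv (congrFun h0 i)
  have a1 := h1 (Sum.elim ![1, 1] ![0, 0]) (hne _ (.inl 0) (by simp))
  have a2 := h1 (Sum.elim ![1, -1] ![0, 0]) (hne _ (.inl 0) (by simp))
  have a3 := h1 (Sum.elim ![0, 0] ![1, 1]) (hne _ (.inr 0) (by simp))
  have a4 := h1 (Sum.elim ![0, 0] ![1, -1]) (hne _ (.inr 0) (by simp))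
  rw [dotProduct_mixedProduct] at a1 a2 a3 a4
  norm_num at a1 a2 a3 a4
  exact ⟨by linarith, by linarith, by linarith, by linarith⟩

lemma posDef_mixedProduct {p q r s : ℝ} (hp : 0 < p) (hq : 0 < q) (hr : 0 < r) (hs : 0 < s) :
    (mixedProduct p q r s).PosDef := by
  obtain ⟨e, he0, he⟩ : ∃ e : ℝ, 0 < e ∧ (e ≤ p ∧ e ≤ q ∧ e ≤ r ∧ e ≤ s) :=
    ⟨min (min p q) (min r s), by simp [*], by simp⟩
  have h1 : mixedProduct e e e e = e • 1 := by
    ext i j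
    rcases i with i | i <;> rcases j with j | j <;> fin_cases i <;> fin_cases j <;>
      simp [mixedProduct]
  have h2 := (PosDef.one (n := Fin 2 ⊕ Fin 2) (R := ℝ)).smul he0
  rw [← h1] at h2
  have h3 := h2.add_posSemidef (posSemidef_mixedProduct (sub_nonneg.2 he.1) (sub_nonneg.2 he.2.1)
    (sub_nonneg.2 he.2.2.1) (sub_nonneg.2 he.2.2.2))
  rwa [← mixedProduct_sub, add_sub_cancel] at h3

lemma sq_le_of_dominates_mixedProduct {p q r s t : ℝ} (hr : 0 < r) (hs : 0 < s)
    (h : Dominates (mixedProduct p q r s) (t • symplecticForm (Fin 2))) :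
    t ^ 2 ≤ p * r ∧ t ^ 2 ≤ q * s := by
  have a1 := h.sq_le (Sum.elim ![1, 1] ![0, 0]) (Sum.elim ![0, 0] ![1, 1])
  have a2 := h.sq_le (Sum.elim ![1, -1] ![0, 0]) (Sum.elim ![0, 0] ![1, -1])
  simp only [smul_mulVec, dotProduct_smul, dotProduct_mixedProduct,
    dotProduct_symplecticForm] at a1 a2
  norm_num at a1 a2
  exact ⟨by nlinarith [a1 hr], by nlinarith [a2 hs]⟩

lemma dominates_mixedProduct {p q r s t : ℝ} (hp : 0 < p) (hq : 0 < q) (hr : 0 < r) (hs : 0 < s)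
    (h1 : t ^ 2 ≤ p * r) (h2 : t ^ 2 ≤ q * s) :
    Dominates (mixedProduct p q r s) (t • symplecticForm (Fin 2)) := by
  have key : ∀ {a b : ℝ}, 0 < a → 0 < b → t ^ 2 ≤ a * b → ∀ X Y : ℝ,
      2 * t * (X * Y) ≤ a * X ^ 2 + b * Y ^ 2 := by
    intro a b ha hb hab X Y
    have h3 : (2 * t * (X * Y)) ^ 2 ≤ (a * X ^ 2 + b * Y ^ 2) ^ 2 := by
      nlinarith [sq_nonneg (a * X ^ 2 - b * Y ^ 2),
        mul_le_mul_of_nonneg_right hab (sq_nonneg (X * Y))]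
    exact le_of_abs_le (abs_le_of_sq_le_sq h3 (by positivity))
  intro x y
  simp only [smul_mulVec, dotProduct_smul, dotProduct_mixedProduct, dotProduct_symplecticForm,
    smul_eq_mul]
  have k1 := key hp hr h1 (x (.inl 0) + x (.inl 1)) (y (.inr 0) + y (.inr 1))
  have k2 := key hp hr h1 (y (.inl 0) + y (.inl 1)) (-(x (.inr 0) + x (.inr 1)))
  have k3 := key hq hs h2 (x (.inl 0) - x (.inl 1)) (y (.inr 0) - y (.inr 1))
  have k4 := key hq hs h2 (y (.inl 0) - y (.inl 1)) (-(x (.inr 0) - x (.inr 1)))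
  linarith

/-- The balanced beam splitter that diagonalizes all the states `mixedProduct p q r s`. -/
def balancedMixing : QuadMatrix (Fin 2) :=
  let g : Matrix (Fin 2) (Fin 2) ℝ := !![1 / √2, 1 / √2; 1 / √2, -(1 / √2)]
  fromBlocks g 0 0 g

lemma mixedProduct_eq_conj (p q r s : ℝ) :
    mixedProduct p q r s =
      balancedMixing * diagonal (Sum.elim ![p, q] ![r, s]) * balancedMixingᵀ := by
  have h2 : (√2)⁻¹ * (√2)⁻¹ = (1 / 2 : ℝ) := by
    rw [← mul_inv, Real.mul_self_sqrt (by norm_num)]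
    norm_num
  ext i j
  rcases i with i | i <;> rcases j with j | j <;> fin_cases i <;> fin_cases j <;>
    simp [mixedProduct, balancedMixing, Matrix.mul_apply, Fintype.sum_sum_type,
      Fin.sum_univ_two, diagonal_apply] <;>
    first
    | linear_combination (-(p + q)) * h2
    | linear_combination (-(p - q)) * h2
    | linear_combination (-(r + s)) * h2
    | linear_combination (-(r - s)) * h2

lemma isPassive_fromBlocks {ι : Type} [Fintype ι] [DecidableEq ι] {g : Matrix ι ι ℝ}
    (hg : g * gᵀ = 1) : IsPassive (fromBlocks g 0 0 g) := by
  constructor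
  · simp [symplecticForm, fromBlocks_multiply, fromBlocks_transpose, hg]
  · simp [fromBlocks_multiply, fromBlocks_transpose, hg]

lemma balancedMixing_mul_transpose : balancedMixing * balancedMixingᵀ = 1 := by
  have := mixedProduct_eq_conj 1 1 1 1
  have e : diagonal (Sum.elim ![(1 : ℝ), 1] ![1, 1]) = (1 : QuadMatrix (Fin 2)) := by
    rw [← diagonal_one]
    congr 1
    ext i
    rcases i with i | i <;> fin_cases i <;> rfl
  rw [e, Matrix.mul_one] at this
  rw [← this]
  ext i j
  rcases i with i | i <;> rcases j with j | j <;> fin_cases i <;> fin_cases j <;>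
    simp [mixedProduct]

lemma roots_charpoly_mixedProduct (p q r s : ℝ) :
    (mixedProduct p q r s).charpoly.roots = ([p, q, r, s] : List ℝ) := by
  have h1 : balancedMixingᵀ * balancedMixing = 1 := mul_eq_one_comm.1 balancedMixing_mul_transpose
  rw [mixedProduct_eq_conj, charpoly_mul_comm, ← Matrix.mul_assoc, h1, Matrix.one_mul,
    charpoly_diagonal]
  have h2 : ∏ i, (Polynomial.X - Polynomial.C ((Sum.elim ![p, q] ![r, s] : _ → ℝ) i)) =
      (Multiset.map (fun a => Polynomial.X - Polynomial.C a)
        (([p, q, r, s] : List ℝ) : Multiset ℝ)).prod := by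
    simp [Fintype.prod_sum_type, Fin.prod_univ_two, mul_assoc]
  rw [h2, Polynomial.roots_multiset_prod_X_sub_C]

lemma eigUp_of_roots {ι : Type} [Fintype ι] [DecidableEq ι] {V : QuadMatrix ι} {l : List ℝ}
    (h : V.charpoly.roots = l) (hl : l.Pairwise (· ≤ ·)) (k : ℕ) : eigUp V k = l.getD k 0 := by
  rw [eigUp, h, Multiset.coe_sort, List.mergeSort_of_pairwise]
  simpa using hl

end MixedProduct

/-! ### Passive operations, pure product states, and vacuum modes -/

section Passive

variable {ι κ : Type} [Fintype ι] [DecidableEq ι] [Fintype κ] [DecidableEq κ]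

lemma IsPassive.transpose_mul_self {K : QuadMatrix ι} (hK : IsPassive K) : Kᵀ * K = 1 :=
  mul_eq_one_comm.1 hK.2

lemma IsPassive.comm {K : QuadMatrix ι} (hK : IsPassive K) :
    symplecticForm ι * K = K * symplecticForm ι := by
  have := congrArg (· * K) hK.1
  simp only [Matrix.mul_assoc, hK.transpose_mul_self, Matrix.mul_one] at this
  exact this.symm

lemma IsPassive.mul {K L : QuadMatrix ι} (hK : IsPassive K) (hL : IsPassive L) :
    IsPassive (K * L) := by
  constructor
  · rw [transpose_mul]
    calc _ = K * (L * symplecticForm ι * Lᵀ) * Kᵀ := by simp only [Matrix.mul_assoc]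
      _ = _ := by rw [hL.1, hK.1]
  · rw [transpose_mul]
    calc _ = K * (L * Lᵀ) * Kᵀ := by simp only [Matrix.mul_assoc]
      _ = _ := by rw [hL.2, Matrix.mul_one, hK.2]

/-- A passive operation applied to independent squeezed modes with variances `d i`, `1 / d i`. -/
lemma symplectic_passive_conj_diagonal {O : QuadMatrix ι} (hO : IsPassive O) {d e : ι → ℝ}
    (hde : ∀ i, d i * e i = 1) :
    symplecticForm ι * (O * diagonal (Sum.elim d e) * Oᵀ) * (symplecticForm ι)ᵀ *
      (O * diagonal (Sum.elim d e) * Oᵀ) = 1 := by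
  have h1 : symplecticForm ι * diagonal (Sum.elim d e) * (symplecticForm ι)ᵀ *
      diagonal (Sum.elim d e) = 1 := by
    have h2 : (fun i => e i * d i) = fun _ => (1 : ℝ) := funext fun i => by rw [mul_comm, hde]
    have h3 : (fun i => d i * e i) = fun _ => (1 : ℝ) := funext hde
    rw [← fromBlocks_diagonal]
    simp [symplecticForm, fromBlocks_multiply, fromBlocks_transpose, h2, h3, -fromBlocks_diagonal]
  have hc : Oᵀ * (symplecticForm ι)ᵀ = (symplecticForm ι)ᵀ * Oᵀ := by
    rw [← transpose_mul, ← transpose_mul, hO.comm]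
  set D := diagonal (Sum.elim d e)
  calc _ = symplecticForm ι * O * D * (Oᵀ * (symplecticForm ι)ᵀ) * O * D * Oᵀ := by
        simp only [Matrix.mul_assoc]
    _ = O * symplecticForm ι * D * (symplecticForm ι)ᵀ * (Oᵀ * O) * D * Oᵀ := by
        rw [hc, hO.comm]; simp only [Matrix.mul_assoc]
    _ = O * (symplecticForm ι * D * (symplecticForm ι)ᵀ * D) * Oᵀ := by
        rw [hO.transpose_mul_self, Matrix.mul_one]; simp only [Matrix.mul_assoc]
    _ = 1 := by rw [h1, Matrix.mul_one, hO.2]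

lemma posDef_conj_diagonal {n : Type*} [Fintype n] [DecidableEq n] {O : Matrix n n ℝ}
    (hO : O * Oᵀ = 1) {d : n → ℝ} (hd : ∀ i, 0 < d i) : (O * diagonal d * Oᵀ).PosDef := by
  have := posDef_transpose_mul_mul (PosDef.diagonal hd) (W := Oᵀ) (V := O) hO
  rwa [transpose_transpose] at this

lemma isPassive_balancedMixing : IsPassive balancedMixing := by
  have := balancedMixing_mul_transpose
  refine isPassive_fromBlocks ?_
  rw [balancedMixing, fromBlocks_transpose, fromBlocks_multiply, ← fromBlocks_one,
    fromBlocks_inj] at this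
  simpa using this.1

lemma isPure_mixedProduct {p q r s : ℝ} (hp : 0 < p) (hq : 0 < q) (hr : 0 < r) (hs : 0 < s)
    (hpr : p * r = 1) (hqs : q * s = 1) : IsPure (mixedProduct p q r s) := by
  refine isPure_of_symplectic (posDef_mixedProduct hp hq hr hs) ?_
  rw [mixedProduct_eq_conj]
  refine symplectic_passive_conj_diagonal isPassive_balancedMixing fun i => ?_
  fin_cases i
  exacts [hpr, hqs]

/-- The inclusion of the quadratures of the modes `ι` into those of the modes `ι ⊕ κ`. -/
def quadInclusion (ι κ : Type) [DecidableEq ι] : Matrix ((ι ⊕ κ) ⊕ (ι ⊕ κ)) (ι ⊕ ι) ℝ :=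
  fromBlocks (fromRows 1 0) 0 0 (fromRows 1 0)

omit [Fintype κ] [DecidableEq κ] in
lemma fromRows_one_zero_mul (X : Matrix ι ι ℝ) :
    (fromRows 1 0 : Matrix (ι ⊕ κ) ι ℝ) * X * (fromRows 1 0 : Matrix (ι ⊕ κ) ι ℝ)ᵀ =
      fromBlocks X 0 0 0 := by
  rw [fromRows_mul, transpose_fromRows, fromRows_mul_fromCols]
  simp

omit [DecidableEq κ] in
lemma quadInclusion_transpose_mul : (quadInclusion ι κ)ᵀ * quadInclusion ι κ = 1 := by
  simp [quadInclusion, fromBlocks_transpose, fromBlocks_multiply, transpose_fromRows,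
    fromCols_mul_fromRows]

lemma quadInclusion_transpose_mul_symplecticForm :
    (quadInclusion ι κ)ᵀ * symplecticForm (ι ⊕ κ) =
      symplecticForm ι * (quadInclusion ι κ)ᵀ := by
  simp [quadInclusion, symplecticForm, fromBlocks_transpose, fromBlocks_multiply]

lemma traceOut_eq (M : QuadMatrix (ι ⊕ κ)) :
    traceOut M = (quadInclusion ι κ)ᵀ * M * quadInclusion ι κ := by
  have h1 : quadInclusion ι κ =
      (1 : QuadMatrix (ι ⊕ κ)).submatrix id (Sum.map Sum.inl Sum.inl) := by
    ext i j
    rcases i with (i | i) | (i | i) <;> rcases j with j | j <;>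
      simp [quadInclusion, one_apply]
  rw [h1, transpose_submatrix, transpose_one]
  ext i j
  simp [traceOut, Matrix.mul_apply, one_apply]

omit [Fintype κ] in
lemma addVacuum_sub (M N : QuadMatrix ι) :
    addVacuum κ M - addVacuum κ N = quadInclusion ι κ * (M - N) * (quadInclusion ι κ)ᵀ := by
  rw [← fromBlocks_toBlocks (M - N), quadInclusion, fromBlocks_transpose, fromBlocks_multiply,
    fromBlocks_multiply]
  simp only [Matrix.zero_mul, Matrix.mul_zero, transpose_zero, add_zero, zero_add,
    fromRows_one_zero_mul]
  ext i j
  rcases i with (i | i) | (i | i) <;> rcases j with (j | j) | (j | j) <;>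
    simp [addVacuum, toBlocks₁₁, toBlocks₁₂, toBlocks₂₁, toBlocks₂₂]

lemma addVacuum_conj_diagonal (g : Matrix ι ι ℝ) (d e : ι → ℝ) :
    addVacuum κ (fromBlocks g 0 0 g * diagonal (Sum.elim d e) * (fromBlocks g 0 0 g)ᵀ) =
      fromBlocks (fromBlocks g 0 0 1) 0 0 (fromBlocks g 0 0 1) *
        diagonal (Sum.elim (Sum.elim d 1) (Sum.elim e 1)) *
        (fromBlocks (fromBlocks g 0 0 (1 : Matrix κ κ ℝ)) 0 0 (fromBlocks g 0 0 1))ᵀ := by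
  have h1 : (diagonal (1 : κ → ℝ)) = 1 := diagonal_one
  simp only [← fromBlocks_diagonal, fromBlocks_transpose, fromBlocks_multiply, h1,
    transpose_zero, transpose_one, Matrix.zero_mul, Matrix.mul_zero, Matrix.mul_one, add_zero,
    zero_add, addVacuum, toBlocks_fromBlocks₁₁, toBlocks_fromBlocks₁₂, toBlocks_fromBlocks₂₁,
    toBlocks_fromBlocks₂₂, fromBlocks_zero]

end Passive

/-! ### Bounds on the entanglement of formation -/

section Entanglement

/-- Reversal of the momentum of the second of two modes. -/
def momentumReversal : QuadMatrix (Fin 2) := diagonal (Sum.elim ![1, 1] ![1, -1])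

lemma momentumReversal_transpose : momentumReversalᵀ = momentumReversal := diagonal_transpose _

lemma momentumReversal_mul_self : momentumReversal * momentumReversal = 1 := by
  rw [momentumReversal, diagonal_mul_diagonal, ← diagonal_one]
  congr 1
  ext i
  rcases i with i | i <;> fin_cases i <;> simp

lemma partialTranspose_eq (P : QuadMatrix (Fin 2)) :
    partialTranspose P = momentumReversalᵀ * P * momentumReversal := by
  rw [momentumReversal_transpose]
  rfl

lemma posDef_partialTranspose {P : QuadMatrix (Fin 2)} (hP : P.PosDef) :
    (partialTranspose P).PosDef := by
  rw [partialTranspose_eq]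
  exact posDef_transpose_mul_mul hP momentumReversal_mul_self

lemma partialTranspose_mixedProduct (p q r s : ℝ) :
    partialTranspose (mixedProduct p q r s) = mixedProduct p q s r := by
  rw [partialTranspose_eq, momentumReversal_transpose]
  ext i j
  rw [momentumReversal, mul_diagonal, diagonal_mul]
  rcases i with i | i <;> rcases j with j | j <;> fin_cases i <;> fin_cases j <;>
    simp [mixedProduct] <;> ring

lemma pureEntanglement_nonneg {P : QuadMatrix (Fin 2)} (hP : P.PosDef) :
    0 ≤ pureEntanglement P := by
  rw [pureEntanglement]
  split_ifs with h1
  · exact h_nonneg (minSymplecticEigenvalue_pos (posDef_partialTranspose hP)) h1.le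
  · exact le_rfl

lemma pureEntanglement_le {P : QuadMatrix (Fin 2)} (hP : P.PosDef) {m : ℝ} (hm0 : 0 < m)
    (hm1 : m ≤ 1) (hd : Dominates (partialTranspose P) (m • symplecticForm (Fin 2))) :
    pureEntanglement P ≤ h m := by
  rw [pureEntanglement]
  split_ifs with h1
  · exact h_le_h hm0 (le_minSymplecticEigenvalue (posDef_partialTranspose hP) hd) h1.le
  · exact h_nonneg hm0 hm1

lemma mem_pureDecompositions {ι : Type} [Fintype ι] [DecidableEq ι] {V P : QuadMatrix ι}
    (hP : IsPure P) (h1 : (V - P).PosSemidef) : P ∈ pureDecompositions V :=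
  ⟨hP, V - P, h1, (add_sub_cancel _ _).symm⟩

lemma posSemidef_sub_of_mem {ι : Type} [Fintype ι] [DecidableEq ι] {V P : QuadMatrix ι}
    (hP : P ∈ pureDecompositions V) : (V - P).PosSemidef := by
  obtain ⟨N, hN, rfl⟩ := hP.2
  rwa [add_sub_cancel_left]

lemma eof_nonneg (V : QuadMatrix (Fin 2)) : 0 ≤ eof V := by
  refine Real.sInf_nonneg ?_
  rintro _ ⟨P, hP, rfl⟩
  exact pureEntanglement_nonneg hP.1.1.1

lemma eof_le {V P : QuadMatrix (Fin 2)} (hP : P ∈ pureDecompositions V) {m : ℝ} (hm0 : 0 < m)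
    (hm1 : m ≤ 1) (hd : Dominates (partialTranspose P) (m • symplecticForm (Fin 2))) :
    eof V ≤ h m := by
  refine (csInf_le ⟨0, ?_⟩ (Set.mem_image_of_mem _ hP)).trans
    (pureEntanglement_le hP.1.1.1 hm0 hm1 hd)
  rintro _ ⟨P', hP', rfl⟩
  exact pureEntanglement_nonneg hP'.1.1.1

/-- The smallest symplectic eigenvalue of the partial transpose is monotone, so the one of a
`mixedProduct` bounds those of all pure states below it. -/
lemma le_eof_mixedProduct {p q r s m : ℝ} (hV : (mixedProduct p q r s).PosDef)
    (hne : (pureDecompositions (mixedProduct p q r s)).Nonempty) (hm0 : 0 < m) (hm1 : m ≤ 1)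
    (hle : p * s ≤ m ^ 2 ∨ q * r ≤ m ^ 2) : h m ≤ eof (mixedProduct p q r s) := by
  obtain ⟨hp, hq, hr, hs⟩ := pos_of_posDef_mixedProduct hV
  refine le_csInf (hne.image _) ?_
  rintro _ ⟨P, hP, rfl⟩
  have hPT := posDef_partialTranspose hP.1.1.1
  set t := minSymplecticEigenvalue (partialTranspose P) with ht
  have ht0 : 0 < t := minSymplecticEigenvalue_pos hPT
  have h1 := dominates_of_le_minSymplecticEigenvalue hPT ht0.le le_rfl
  have h2 : (mixedProduct p q s r - partialTranspose P).PosSemidef := by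
    rw [← partialTranspose_mixedProduct, partialTranspose_eq, partialTranspose_eq,
      ← Matrix.sub_mul, ← Matrix.mul_sub]
    exact posSemidef_transpose_mul_mul (posSemidef_sub_of_mem hP) _
  have h3 := sq_le_of_dominates_mixedProduct hs hr (h1.mono h2)
  have h4 : t ≤ m := by
    refine le_of_abs_le (abs_le_of_sq_le_sq ?_ hm0.le)
    rcases hle with h5 | h5
    · exact h3.1.trans h5
    · exact h3.2.trans h5
  rw [pureEntanglement, ← ht]
  split_ifs with h5
  · exact h_le_h ht0 h4 hm1
  · have : m = 1 := le_antisymm hm1 ((not_lt.1 h5).trans h4)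
    rw [this, h_one]

/-- A compression of an orthogonal matrix is a contraction. -/
lemma dotProduct_conj_contraction {m n : Type*} [Fintype m] [DecidableEq m] [Fintype n]
    [DecidableEq n] {U : Matrix m n ℝ} (hU : U * Uᵀ = 1) {A : Matrix m m ℝ} (hA : Aᵀ * A = 1)
    (y : n → ℝ) : ((Uᵀ * A * U) *ᵥ y) ⬝ᵥ ((Uᵀ * A * U) *ᵥ y) ≤ y ⬝ᵥ y := by
  have h1 := dotProduct_self_nonneg' (y - (Uᵀ * U) *ᵥ y)
  have h2 : ∀ M : Matrix n n ℝ, (M *ᵥ y) ⬝ᵥ (M *ᵥ y) = y ⬝ᵥ (Mᵀ * M) *ᵥ y := by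
    intro M
    rw [dotProduct_mulVec_of_transpose, dotProduct_comm, mulVec_mulVec]
  have h3 : (Uᵀ * A * U)ᵀ * (Uᵀ * A * U) = Uᵀ * U := by
    rw [transpose_mul, transpose_mul, transpose_transpose]
    calc _ = Uᵀ * (Aᵀ * (U * Uᵀ) * A) * U := by simp only [Matrix.mul_assoc]
      _ = Uᵀ * U := by rw [hU, Matrix.mul_one, hA, Matrix.mul_one]
  have h4 : (Uᵀ * U)ᵀ * (Uᵀ * U) = Uᵀ * U := by
    rw [transpose_mul, transpose_transpose]
    calc _ = Uᵀ * (U * Uᵀ) * U := by simp only [Matrix.mul_assoc]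
      _ = Uᵀ * U := by rw [hU, Matrix.mul_one]
  rw [sub_dotProduct, dotProduct_sub, dotProduct_sub, h2 (Uᵀ * U), h4,
    dotProduct_comm ((Uᵀ * U) *ᵥ y) y] at h1
  rw [h2, h3]
  linarith

/-- Passive operations, vacuum modes and partial traces do not increase the squeezing of a state
above a pure product state, and the squeezing bounds the entanglement: `m²` bounds the products of
pairs of eigenvalues of the pure state from below. -/
lemma exists_mem_pureDecompositions_passiveOutput {σ : QuadMatrix (Fin 2)} {p q r s m : ℝ}
    (hp : 0 < p) (hq : 0 < q) (hr : 0 < r) (hs : 0 < s) (hpr : p * r = 1) (hqs : q * s = 1)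
    (hσ : (σ - mixedProduct p q r s).PosSemidef) (hm : m ^ 2 ≤ 1)
    (hpq : m ^ 2 ≤ p * q) (hps : m ^ 2 ≤ p * s) (hrq : m ^ 2 ≤ r * q) (hrs : m ^ 2 ≤ r * s)
    {n : ℕ} {K : QuadMatrix (Fin 2 ⊕ Fin n)} (hK : IsPassive K) :
    ∃ P ∈ pureDecompositions (passiveOutput K σ),
      Dominates (partialTranspose P) (m • symplecticForm (Fin 2)) := by
  set g : Matrix (Fin 2) (Fin 2) ℝ := !![1 / √2, 1 / √2; 1 / √2, -(1 / √2)] with hg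
  have hbg : balancedMixing = fromBlocks g 0 0 g := rfl
  have hgg : g * gᵀ = 1 := by
    have := balancedMixing_mul_transpose
    rw [hbg, fromBlocks_transpose, fromBlocks_multiply, ← fromBlocks_one, fromBlocks_inj] at this
    simpa using this.1
  have hgg' : fromBlocks g 0 0 (1 : Matrix (Fin n) (Fin n) ℝ) * (fromBlocks g 0 0 1)ᵀ = 1 := by
    simp [fromBlocks_transpose, fromBlocks_multiply, hgg]
  set O := K * fromBlocks (fromBlocks g 0 0 (1 : Matrix (Fin n) (Fin n) ℝ)) 0 0
    (fromBlocks g 0 0 1) with hO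
  have hOp : IsPassive O := hK.mul (isPassive_fromBlocks hgg')
  set d : Fin 2 ⊕ Fin n → ℝ := Sum.elim ![p, q] 1 with hd
  set e : Fin 2 ⊕ Fin n → ℝ := Sum.elim ![r, s] 1 with he
  have hde : ∀ i, d i * e i = 1 := by
    rintro (i | i)
    · fin_cases i
      exacts [hpr, hqs]
    · simp [d, e]
  have hpos : ∀ i, 0 < Sum.elim d e i := by
    rintro ((i | i) | (i | i)) <;> first | (fin_cases i <;> simp [d, e, *]) | simp [d, e]
  have hG : K * addVacuum (Fin n) (mixedProduct p q r s) * Kᵀ =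
      O * diagonal (Sum.elim d e) * Oᵀ := by
    rw [mixedProduct_eq_conj, hbg, addVacuum_conj_diagonal, hO, transpose_mul]
    simp only [Matrix.mul_assoc, hd, he]
  set G := O * diagonal (Sum.elim d e) * Oᵀ with hGdef
  set V := quadInclusion (Fin 2) (Fin n) with hV
  obtain ⟨P, W, hP, hle, hVW, hge⟩ := exists_symplectic_compression
    (quadInclusion_transpose_mul (ι := Fin 2) (κ := Fin n))
    quadInclusion_transpose_mul_symplecticForm (posDef_conj_diagonal hOp.2 hpos)
    (symplectic_passive_conj_diagonal hOp hde)
  refine ⟨P, mem_pureDecompositions hP ?_, ?_⟩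
  · have h1 := posSemidef_transpose_mul_mul hσ (Vᵀ * K * V)ᵀ
    have h2 : passiveOutput K σ - Vᵀ * G * V =
        ((Vᵀ * K * V)ᵀ)ᵀ * (σ - mixedProduct p q r s) * (Vᵀ * K * V)ᵀ := by
      rw [passiveOutput, traceOut_eq, ← hG, ← hV, ← Matrix.sub_mul, ← Matrix.mul_sub,
        ← Matrix.sub_mul, ← Matrix.mul_sub, addVacuum_sub, ← hV]
      simp only [transpose_mul, transpose_transpose, Matrix.mul_assoc]
    rw [← h2] at h1
    have h3 := h1.add hle
    rwa [sub_add_sub_cancel] at h3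
  · -- Partial transposition replaces `Ω` by the antisymmetric orthogonal matrix `A₀`, and a
    -- compression of `A₀` to the frame of the squeezed modes is still a contraction.
    set A₀ := momentumReversal * symplecticForm (Fin 2) * momentumReversal with hA₀
    have hA₀t : A₀ᵀ = -A₀ := by
      rw [hA₀, transpose_mul, transpose_mul, momentumReversal_transpose, symplecticForm_transpose]
      simp [Matrix.mul_assoc]
    have hA₀o : A₀ᵀ * A₀ = 1 := by
      rw [hA₀t, hA₀, Matrix.neg_mul]
      calc _ = -(momentumReversal * symplecticForm (Fin 2) *
            (momentumReversal * momentumReversal) * symplecticForm (Fin 2) * momentumReversal) := by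
            simp only [Matrix.mul_assoc]
        _ = -(momentumReversal * (symplecticForm (Fin 2) * symplecticForm (Fin 2)) *
            momentumReversal) := by
            rw [momentumReversal_mul_self, Matrix.mul_one]; simp only [Matrix.mul_assoc]
        _ = 1 := by
            rw [symplecticForm_mul_self]
            simp [momentumReversal_mul_self]
    obtain ⟨U, hU⟩ : ∃ U, U = Vᵀ * O := ⟨_, rfl⟩
    have hUU : U * Uᵀ = 1 := by
      rw [hU, transpose_mul, transpose_transpose]
      calc _ = Vᵀ * (O * Oᵀ) * V := by simp only [Matrix.mul_assoc]
        _ = 1 := by rw [hOp.2, Matrix.mul_one, hV, quadInclusion_transpose_mul]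
    have hc := dotProduct_conj_contraction hUU hA₀o
    have hm' := (sq_le_one_iff_abs_le_one m).1 hm
    have hdd : ∀ i j, i ≠ j → m ^ 2 ≤ Sum.elim d e i * Sum.elim d e j := by
      have hp' : m ^ 2 ≤ p := by
        rcases le_total q 1 with h1 | h1
        · nlinarith
        · nlinarith
      have hr' : m ^ 2 ≤ r := by
        rcases le_total q 1 with h1 | h1
        · nlinarith
        · nlinarith
      have hq' : m ^ 2 ≤ q := by
        rcases le_total p 1 with h1 | h1
        · nlinarith
        · nlinarith
      have hs' : m ^ 2 ≤ s := by
        rcases le_total p 1 with h1 | h1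
        · nlinarith
        · nlinarith
      rintro ((i | i) | (i | i)) ((j | j) | (j | j)) hij <;> (try fin_cases i) <;>
        (try fin_cases j) <;> first | exact absurd rfl hij | (simp [d, e]; linarith)
    have hAt : (Uᵀ * A₀ * U)ᵀ = -(Uᵀ * A₀ * U) := by
      rw [transpose_mul, transpose_mul, transpose_transpose, hA₀t]
      simp [Matrix.mul_assoc]
    have h1 := ((dominates_diagonal (fun i => (hpos i).le) hdd hAt hc).conj (Oᵀ * W))
    have h2 : (Oᵀ * W)ᵀ * diagonal (Sum.elim d e) * (Oᵀ * W) = Wᵀ * G * W := by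
      rw [transpose_mul, transpose_transpose, hGdef]
      simp only [Matrix.mul_assoc]
    have hUW : U * (Oᵀ * W) = 1 := by
      rw [hU]
      calc _ = Vᵀ * (O * Oᵀ) * W := by simp only [Matrix.mul_assoc]
        _ = 1 := by rw [hOp.2, Matrix.mul_one, hVW]
    have h3 : (Oᵀ * W)ᵀ * (m • (Uᵀ * A₀ * U)) * (Oᵀ * W) = m • A₀ := by
      rw [Matrix.mul_smul, Matrix.smul_mul]
      calc _ = m • ((U * (Oᵀ * W))ᵀ * A₀ * (U * (Oᵀ * W))) := by
            rw [transpose_mul U]; simp only [Matrix.mul_assoc]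
        _ = m • A₀ := by rw [hUW]; simp
    rw [h2, h3] at h1
    have h4 := (h1.mono hge).conj momentumReversal
    rw [partialTranspose_eq]
    have h5 : momentumReversalᵀ * (m • A₀) * momentumReversal = m • symplecticForm (Fin 2) := by
      rw [Matrix.mul_smul, Matrix.smul_mul, momentumReversal_transpose, hA₀]
      congr 1
      calc _ = (momentumReversal * momentumReversal) * symplecticForm (Fin 2) *
            (momentumReversal * momentumReversal) := by simp only [Matrix.mul_assoc]
        _ = _ := by rw [momentumReversal_mul_self, Matrix.one_mul, Matrix.mul_one]
    rwa [h5] at h4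

end Entanglement

/-! ### Squeezing of pure two-mode states -/

section Squeezing

lemma exists_sorted_eigenframe {P : QuadMatrix (Fin 2)} (hP : P.PosDef) :
    ∃ (U : QuadMatrix (Fin 2)) (d : Fin 2 ⊕ Fin 2 → ℝ) (τ : Fin 4 ≃ Fin 2 ⊕ Fin 2),
      U * Uᵀ = 1 ∧ P = U * diagonal d * Uᵀ ∧ (∀ i, 0 < d i) ∧ Monotone (d ∘ τ) ∧
      eigUp P 0 = d (τ 0) ∧ eigUp P 1 = d (τ 1) := by
  have hH := hP.isHermitian
  set d := hH.eigenvalues with hd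
  set e : Fin 4 ≃ Fin 2 ⊕ Fin 2 := (finSumFinEquiv (m := 2) (n := 2)).symm with he
  set τ : Fin 4 ≃ Fin 2 ⊕ Fin 2 := (Tuple.sort (d ∘ e)).trans e with hτ
  have hmono : Monotone (d ∘ τ) := Tuple.monotone_sort (d ∘ e)
  have hroots : P.charpoly.roots = (List.ofFn (d ∘ τ) : Multiset ℝ) := by
    have h1 := hH.roots_charpoly_eq_eigenvalues
    have h2 : (RCLike.ofReal ∘ hH.eigenvalues : Fin 2 ⊕ Fin 2 → ℝ) = d := rfl
    rw [h1, h2, ← Fin.univ_val_map, ← Multiset.map_map]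
    congr 1
    exact (Multiset.map_univ_val_equiv τ).symm
  have heig := eigUp_of_roots hroots hmono.sortedLE_ofFn.pairwise
  refine ⟨hH.eigenvectorUnitary, d, τ, ?_, ?_, fun i => hP.eigenvalues_pos i, hmono, ?_, ?_⟩
  · have := Unitary.coe_mul_star_self hH.eigenvectorUnitary
    rwa [Unitary.coe_star, star_eq_conjTranspose, conjTranspose_eq_transpose_of_trivial] at this
  · have := hH.spectral_theorem
    rw [Unitary.conjStarAlgAut_apply, star_eq_conjTranspose,
      conjTranspose_eq_transpose_of_trivial] at this
    exact this
  · rw [heig]; rfl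
  · rw [heig]; rfl

lemma dotProduct_conj_diagonal {n : Type*} [Fintype n] [DecidableEq n] (U : Matrix n n ℝ)
    (d x : n → ℝ) : x ⬝ᵥ (U * diagonal d * Uᵀ) *ᵥ x = ∑ i, d i * (Uᵀ *ᵥ x) i ^ 2 := by
  rw [← mulVec_mulVec, ← mulVec_mulVec, dotProduct_mulVec_of_transpose, dotProduct_diagonal_mulVec]
  exact Finset.sum_congr rfl fun i _ => by ring

lemma dotProduct_transpose_mulVec {n : Type*} [Fintype n] [DecidableEq n] {U : Matrix n n ℝ}
    (hU : U * Uᵀ = 1) (x y : n → ℝ) : (Uᵀ *ᵥ x) ⬝ᵥ (Uᵀ *ᵥ y) = x ⬝ᵥ y := by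
  rw [dotProduct_mulVec_of_transpose, transpose_transpose, mulVec_mulVec, hU, one_mulVec]

/-- The product of the two smallest eigenvalues of a pure state is at most the Gram determinant
of the state over two orthonormal vectors, and the second smallest eigenvalue is at most `1`:
the uncertainty relation for the lowest eigenvector `v` and `Ω v` shows that the product of the
extreme eigenvalues is at least `1`, so that of the two middle ones is at most `1`. -/
lemma eigUp_mul_le {P : QuadMatrix (Fin 2)} (hP : IsPure P) :
    0 < eigUp P 0 ∧ 0 < eigUp P 1 ∧ eigUp P 0 * eigUp P 1 ≤ 1 ∧
      (∀ x, eigUp P 0 * eigUp P 1 * (x ⬝ᵥ x) ≤ x ⬝ᵥ P *ᵥ x) ∧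
      ∀ x y, x ⬝ᵥ y = 0 → eigUp P 0 * eigUp P 1 * ((x ⬝ᵥ x) * (y ⬝ᵥ y)) ≤
        (x ⬝ᵥ P *ᵥ x) * (y ⬝ᵥ P *ᵥ y) := by
  obtain ⟨hPd, hPdom⟩ := isCovariance_iff.1 hP.1
  obtain ⟨U, d, τ, hU, hPU, hd, hmono, h0, h1⟩ := exists_sorted_eigenframe hPd
  have hU' : Uᵀ * U = 1 := mul_eq_one_comm.1 hU
  rw [h0, h1]
  have m01 : d (τ 0) ≤ d (τ 1) := hmono (by decide)
  have m12 : d (τ 1) ≤ d (τ 2) := hmono (by decide)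
  have m0 : ∀ i, d (τ 0) ≤ d i := fun i => by
    simpa using hmono (Fin.zero_le (τ.symm i))
  have m3 : ∀ i, d i ≤ d (τ 3) := fun i => by
    simpa using hmono (Fin.le_last (τ.symm i))
  have hdet : d (τ 0) * d (τ 1) * d (τ 2) * d (τ 3) = 1 := by
    have e1 : P.det = ∏ i, d i := by
      have h2 := congrArg det hU
      rw [det_mul, det_one] at h2
      rw [hPU, det_mul, det_mul, det_diagonal]
      linear_combination (∏ i, d i) * h2
    rw [← hP.2, e1, ← Equiv.prod_comp τ, Fin.prod_univ_four]
  have hnorm : ∀ x, ∑ i, (Uᵀ *ᵥ x) i ^ 2 = x ⬝ᵥ x := fun x => by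
    rw [← dotProduct_transpose_mulVec hU x x]
    simp [dotProduct, sq]
  have h03 : 1 ≤ d (τ 0) * d (τ 3) := by
    set v := U *ᵥ Pi.single (τ 0) 1 with hv
    have hUv : Uᵀ *ᵥ v = Pi.single (τ 0) 1 := by
      rw [hv, mulVec_mulVec, hU', one_mulVec]
    have hvP : v ⬝ᵥ P *ᵥ v = d (τ 0) := by
      rw [hPU, dotProduct_conj_diagonal, hUv, Finset.sum_eq_single (τ 0)]
      · simp
      · intro i _ hi
        simp [hi]
      · simp
    have hvv : v ⬝ᵥ v = 1 := by
      rw [← dotProduct_transpose_mulVec hU, hUv]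
      simp
    set w := symplecticForm (Fin 2) *ᵥ v with hw
    have hww : w ⬝ᵥ w = 1 := by
      rw [hw, dotProduct_mulVec_of_transpose, mulVec_mulVec, symplecticForm_transpose_mul,
        one_mulVec, hvv]
    have hwP : w ⬝ᵥ P *ᵥ w ≤ d (τ 3) := by
      rw [hPU, dotProduct_conj_diagonal, ← mul_one (d (τ 3)), ← hww, ← hnorm, Finset.mul_sum]
      exact Finset.sum_le_sum fun i _ => mul_le_mul_of_nonneg_right (m3 i) (sq_nonneg _)
    have h2 := hPdom.sq_le w v (by rw [hvP]; exact hd _)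
    rw [← hw, hww, hvP] at h2
    nlinarith [hd (τ 0)]
  have h2 : d (τ 1) ≤ 1 := by
    have h3 : d (τ 1) * d (τ 2) ≤ 1 := by
      have := mul_le_mul_of_nonneg_left h03 (mul_pos (hd (τ 1)) (hd (τ 2))).le
      nlinarith
    nlinarith [hd (τ 1)]
  have h3 : d (τ 0) * d (τ 1) ≤ d (τ 0) := mul_le_of_le_one_right (hd _).le h2
  refine ⟨hd _, hd _, by linarith, fun x => ?_, fun x y hxy => ?_⟩
  · rw [hPU, dotProduct_conj_diagonal, ← hnorm, Finset.mul_sum]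
    exact Finset.sum_le_sum fun i _ =>
      mul_le_mul_of_nonneg_right (h3.trans (m0 i)) (sq_nonneg _)
  · have hij : ∀ i j, i ≠ j → d (τ 0) * d (τ 1) ≤ d i * d j := by
      have key : ∀ a b : Fin 4, a < b → d (τ 0) * d (τ 1) ≤ d (τ a) * d (τ b) := fun a b hab =>
        mul_le_mul (m0 _) (hmono (show (1 : Fin 4) ≤ b by omega)) (hd _).le (hd _).le
      intro i j hij
      obtain ⟨a, rfl⟩ := τ.surjective i
      obtain ⟨b, rfl⟩ := τ.surjective j
      rcases lt_or_gt_of_ne (fun hab => hij (congrArg τ hab) : a ≠ b) with hab | hab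
      · exact key a b hab
      · rw [mul_comm (d (τ a))]
        exact key b a hab
    have h4 := mul_gram_le_weighted_gram hij (Uᵀ *ᵥ x) (Uᵀ *ᵥ y)
    rw [dotProduct_transpose_mulVec hU, dotProduct_transpose_mulVec hU,
      dotProduct_transpose_mulVec hU, hxy, ← dotProduct_conj_diagonal, ← dotProduct_conj_diagonal,
      ← hPU] at h4
    nlinarith [sq_nonneg (∑ i, d i * (Uᵀ *ᵥ x) i * (Uᵀ *ᵥ y) i)]

lemma eigUp_mul_le_of_mem {P : QuadMatrix (Fin 2)} {p q r s : ℝ}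
    (hP : P ∈ pureDecompositions (mixedProduct p q r s)) :
    eigUp P 0 * eigUp P 1 ≤ min 1 (min p r) * min 1 (min q s) := by
  obtain ⟨h0, h1, hone, hray, hgram⟩ := eigUp_mul_le hP.1
  have hle : ∀ x, x ⬝ᵥ P *ᵥ x ≤ x ⬝ᵥ mixedProduct p q r s *ᵥ x := fun x => by
    have := (posSemidef_real_iff.1 (posSemidef_sub_of_mem hP)).2 x
    rw [sub_mulVec, dotProduct_sub] at this
    linarith
  have hpos : ∀ x, 0 ≤ x ⬝ᵥ P *ᵥ x := (posSemidef_real_iff.1 hP.1.1.1.posSemidef).2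
  have hx : ∀ x c, x ⬝ᵥ x = 2 → x ⬝ᵥ mixedProduct p q r s *ᵥ x = 2 * c →
      eigUp P 0 * eigUp P 1 ≤ c := fun x c h2 hc => by
    have := (hray x).trans (hle x)
    rw [h2, hc] at this
    linarith
  have hxy : ∀ x y c c', x ⬝ᵥ x = 2 → y ⬝ᵥ y = 2 → x ⬝ᵥ y = 0 →
      x ⬝ᵥ mixedProduct p q r s *ᵥ x = 2 * c → y ⬝ᵥ mixedProduct p q r s *ᵥ y = 2 * c' →
      eigUp P 0 * eigUp P 1 ≤ c * c' := fun x y c c' h2 h2' h3 hc hc' => by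
    have := (hgram x y h3).trans
      (mul_le_mul (hle x) (hle y) (hpos y) ((hpos x).trans (hle x)))
    rw [h2, h2', hc, hc'] at this
    linarith
  -- the eigenvectors of `mixedProduct p q r s`
  set v₁ : Fin 2 ⊕ Fin 2 → ℝ := Sum.elim ![1, 1] ![0, 0] with hv₁
  set v₂ : Fin 2 ⊕ Fin 2 → ℝ := Sum.elim ![1, -1] ![0, 0] with hv₂
  set v₃ : Fin 2 ⊕ Fin 2 → ℝ := Sum.elim ![0, 0] ![1, 1] with hv₃
  set v₄ : Fin 2 ⊕ Fin 2 → ℝ := Sum.elim ![0, 0] ![1, -1] with hv₄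
  have n₁ : v₁ ⬝ᵥ v₁ = 2 := by norm_num [v₁, dotProduct, Fintype.sum_sum_type]
  have n₂ : v₂ ⬝ᵥ v₂ = 2 := by norm_num [v₂, dotProduct, Fintype.sum_sum_type]
  have n₃ : v₃ ⬝ᵥ v₃ = 2 := by norm_num [v₃, dotProduct, Fintype.sum_sum_type]
  have n₄ : v₄ ⬝ᵥ v₄ = 2 := by norm_num [v₄, dotProduct, Fintype.sum_sum_type]
  have o₁₂ : v₁ ⬝ᵥ v₂ = 0 := by norm_num [v₁, v₂, dotProduct, Fintype.sum_sum_type]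
  have o₁₄ : v₁ ⬝ᵥ v₄ = 0 := by norm_num [v₁, v₄, dotProduct, Fintype.sum_sum_type]
  have o₃₂ : v₃ ⬝ᵥ v₂ = 0 := by norm_num [v₃, v₂, dotProduct, Fintype.sum_sum_type]
  have o₃₄ : v₃ ⬝ᵥ v₄ = 0 := by norm_num [v₃, v₄, dotProduct, Fintype.sum_sum_type]
  have e₁ : v₁ ⬝ᵥ mixedProduct p q r s *ᵥ v₁ = 2 * p := by
    rw [dotProduct_mixedProduct]; simp [v₁]; ring
  have e₂ : v₂ ⬝ᵥ mixedProduct p q r s *ᵥ v₂ = 2 * q := by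
    rw [dotProduct_mixedProduct]; simp [v₂]; ring
  have e₃ : v₃ ⬝ᵥ mixedProduct p q r s *ᵥ v₃ = 2 * r := by
    rw [dotProduct_mixedProduct]; simp [v₃]; ring
  have e₄ : v₄ ⬝ᵥ mixedProduct p q r s *ᵥ v₄ = 2 * s := by
    rw [dotProduct_mixedProduct]; simp [v₄]; ring
  have c₁ := hx _ _ n₁ e₁
  have c₂ := hx _ _ n₂ e₂
  have c₃ := hx _ _ n₃ e₃
  have c₄ := hx _ _ n₄ e₄
  have c₁₂ := hxy _ _ _ _ n₁ n₂ o₁₂ e₁ e₂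
  have c₁₄ := hxy _ _ _ _ n₁ n₄ o₁₄ e₁ e₄
  have c₃₂ := hxy _ _ _ _ n₃ n₂ o₃₂ e₃ e₂
  have c₃₄ := hxy _ _ _ _ n₃ n₄ o₃₄ e₃ e₄
  rcases min_choice 1 (min p r) with ha | ha <;> rcases min_choice 1 (min q s) with hb | hb <;>
    rcases min_choice p r with ha' | ha' <;> rcases min_choice q s with hb' | hb' <;>
    rw [ha, hb] <;> simp only [ha', hb', one_mul, mul_one] <;> assumption

/-- For a pure product state behind a beam splitter, the two smallest eigenvalues are the squeezed
variances of the two modes. -/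
lemma eigUp_mul_mixedProduct {p q r s : ℝ} (hp : 0 < p) (hq : 0 < q) (hr : 0 < r) (hs : 0 < s)
    (hpr : p * r = 1) (hqs : q * s = 1) :
    eigUp (mixedProduct p q r s) 0 * eigUp (mixedProduct p q r s) 1 = min p r * min q s := by
  have key : ∀ u w w' u' : ℝ, 0 < u → 0 < w → u ≤ w → w ≤ w' → u * u' = 1 → w * w' = 1 →
      [p, q, r, s].Perm [u, w, w', u'] →
      eigUp (mixedProduct p q r s) 0 * eigUp (mixedProduct p q r s) 1 = u * w := by
    intro u w w' u' hu hw huw hww' hu' hw' hperm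
    have h1 : w' ≤ u' := by
      by_contra hc
      push Not at hc
      nlinarith
    have h2 : (mixedProduct p q r s).charpoly.roots = ([u, w, w', u'] : List ℝ) := by
      rw [roots_charpoly_mixedProduct, Multiset.coe_eq_coe]
      exact hperm
    have h3 := eigUp_of_roots h2 (by simp [*, huw.trans hww', (huw.trans hww').trans h1,
      hww'.trans h1])
    rw [h3, h3]
    rfl
  have perm : ∀ {l₁ l₂ : List ℝ}, (∀ a, l₁.count a = l₂.count a) → l₁.Perm l₂ :=
    fun h => List.perm_iff_count.2 h
  rcases le_total p r with h1 | h1 <;> rcases le_total q s with h2 | h2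
  · rw [min_eq_left h1, min_eq_left h2]
    rcases le_total p q with h3 | h3
    · exact key p q s r hp hq h3 h2 hpr hqs (perm fun a => by
        simp only [List.count_cons, List.count_nil]; ring)
    · rw [mul_comm p]
      exact key q p r s hq hp h3 h1 hqs hpr (perm fun a => by
        simp only [List.count_cons, List.count_nil]; ring)
  · rw [min_eq_left h1, min_eq_right h2]
    rcases le_total p s with h3 | h3
    · exact key p s q r hp hs h3 h2 hpr (by linarith) (perm fun a => by
        simp only [List.count_cons, List.count_nil]; ring)
    · rw [mul_comm p]
      exact key s p r q hs hp h3 h1 (by linarith) hpr (perm fun a => by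
        simp only [List.count_cons, List.count_nil]; ring)
  · rw [min_eq_right h1, min_eq_left h2]
    rcases le_total r q with h3 | h3
    · exact key r q s p hr hq h3 h2 (by linarith) hqs (perm fun a => by
        simp only [List.count_cons, List.count_nil]; ring)
    · rw [mul_comm r]
      exact key q r p s hq hr h3 h1 hqs (by linarith) (perm fun a => by
        simp only [List.count_cons, List.count_nil]; ring)
  · rw [min_eq_right h1, min_eq_right h2]
    rcases le_total r s with h3 | h3
    · exact key r s q p hr hs h3 h2 (by linarith) (by linarith) (perm fun a => by
        simp only [List.count_cons, List.count_nil]; ring)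
    · rw [mul_comm r]
      exact key s r p q hs hr h3 h1 (by linarith) (by linarith) (perm fun a => by
        simp only [List.count_cons, List.count_nil]; ring)

lemma pureSqueezing_eq {P : QuadMatrix (Fin 2)} (hP : IsPure P) :
    pureSqueezing P = -(1 / 2) * Real.log (eigUp P 0 * eigUp P 1) := by
  obtain ⟨h0, h1, -⟩ := eigUp_mul_le hP
  rw [pureSqueezing, Real.log_mul h0.ne' h1.ne']
  simp [Finset.sum_range_succ]

/-- A single-mode state lies above a pure state with the same squeezing below the vacuum level. -/
lemma exists_pure_variances {p r : ℝ} (hp : 0 < p) (hr : 0 < r) (hpr : 1 ≤ p * r) :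
    ∃ p' r', 0 < p' ∧ 0 < r' ∧ p' * r' = 1 ∧ p' ≤ p ∧ r' ≤ r ∧
      min p' r' = min 1 (min p r) := by
  rcases le_total p 1 with h1 | h1
  · have h2 : 1 / p ≤ r := by rwa [div_le_iff₀ hp, mul_comm]
    have h3 : 1 ≤ 1 / p := by rwa [le_div_iff₀ hp, one_mul]
    refine ⟨p, 1 / p, hp, by positivity, mul_one_div_cancel hp.ne', le_rfl, h2, ?_⟩
    rw [min_eq_left (h1.trans h3), min_eq_left (h1.trans (h3.trans h2)), min_eq_right h1]
  · rcases le_total r 1 with h2 | h2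
    · have h3 : 1 / r ≤ p := by rwa [div_le_iff₀ hr]
      have h4 : 1 ≤ 1 / r := by rwa [le_div_iff₀ hr, one_mul]
      refine ⟨1 / r, r, by positivity, hr, one_div_mul_cancel hr.ne', h3, le_rfl, ?_⟩
      rw [min_eq_right (h2.trans h4), min_eq_right (h2.trans (h4.trans h3)), min_eq_right h2]
    · refine ⟨1, 1, one_pos, one_pos, one_mul 1, h1, h2, ?_⟩
      rw [min_self, min_eq_left (le_min h1 h2)]

end Squeezing

/-! ### The swap network -/

section SwapNetwork

lemma modeRotation_mul_transpose {i j : Fin 2 ⊕ Fin 1} (hij : i ≠ j) (θ : ℝ) :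
    modeRotation i j θ * (modeRotation i j θ)ᵀ = 1 := by
  have h1 : Real.cos θ * Real.cos θ + Real.sin θ * Real.sin θ = 1 := by
    nlinarith [Real.sin_sq_add_cos_sq θ]
  ext k l
  rcases i with i | i <;> rcases j with j | j <;> fin_cases i <;> fin_cases j <;>
    first
    | exact absurd rfl hij
    | (rcases k with k | k <;> rcases l with l | l <;> fin_cases k <;> fin_cases l <;>
        simp [Matrix.mul_apply, modeRotation, Fintype.sum_sum_type, Fin.sum_univ_two] <;>
        linarith)

lemma isPassive_beamSplitter {i j : Fin 2 ⊕ Fin 1} (hij : i ≠ j) (θ : ℝ) :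
    IsPassive (beamSplitter i j θ) :=
  isPassive_fromBlocks (modeRotation_mul_transpose hij θ)

lemma isPassive_swapNetwork (k : Fin 2) : IsPassive (swapNetwork k) :=
  ((isPassive_beamSplitter (by simp) _).mul (isPassive_beamSplitter (by simp) _)).mul
    (isPassive_beamSplitter (by simp) _)

/-- The output of a passive operation acting alike on positions and momenta depends only on its
rows for the output modes. -/
lemma passiveOutput_fromBlocks {n : ℕ} {G : Matrix (Fin 2 ⊕ Fin n) (Fin 2 ⊕ Fin n) ℝ}
    {A : Matrix (Fin 2) (Fin 2) ℝ} {B : Matrix (Fin 2) (Fin n) ℝ}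
    (hG : G.submatrix Sum.inl id = fromCols A B) (X Y : Matrix (Fin 2) (Fin 2) ℝ) :
    passiveOutput (fromBlocks G 0 0 G) (fromBlocks X 0 0 Y) =
      fromBlocks (A * X * Aᵀ + B * Bᵀ) 0 0 (A * Y * Aᵀ + B * Bᵀ) := by
  have key : ∀ Z : Matrix (Fin 2) (Fin 2) ℝ,
      (G * fromBlocks Z 0 0 (1 : Matrix (Fin n) (Fin n) ℝ) * Gᵀ).submatrix Sum.inl Sum.inl =
        A * Z * Aᵀ + B * Bᵀ := by
    intro Z
    set H : Matrix (Fin 2) (Fin 2 ⊕ Fin n) ℝ := G.submatrix Sum.inl id with hH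
    have h1 : (G * fromBlocks Z 0 0 (1 : Matrix (Fin n) (Fin n) ℝ) * Gᵀ).submatrix
        (Sum.inl : Fin 2 → Fin 2 ⊕ Fin n) Sum.inl =
          H * fromBlocks Z 0 0 (1 : Matrix (Fin n) (Fin n) ℝ) * Hᵀ := by
      ext i j
      simp [hH, Matrix.mul_apply]
    have h2 : fromCols A B * fromBlocks Z 0 0 (1 : Matrix (Fin n) (Fin n) ℝ) =
        fromCols (A * Z) B := by
      ext i j
      rcases j with j | j <;> simp [Matrix.mul_apply, Fintype.sum_sum_type, one_apply]
    rw [h1, hG, h2]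
    ext i j
    simp [Matrix.mul_apply, Fintype.sum_sum_type]
  have hadd : addVacuum (Fin n) (fromBlocks X 0 0 Y) =
      fromBlocks (fromBlocks X 0 0 1) 0 0 (fromBlocks Y 0 0 1) := by
    simp [addVacuum]
  rw [passiveOutput, hadd, fromBlocks_transpose, fromBlocks_multiply, fromBlocks_multiply,
    ← key X, ← key Y]
  ext i j
  rcases i with i | i <;> rcases j with j | j <;> simp [traceOut]

lemma swapNetwork_eq (k : Fin 2) :
    swapNetwork k =
      let G := modeRotation (Sum.inl 0) (Sum.inl 1) (Real.pi / 4) *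
        modeRotation (Sum.inl k) (Sum.inr 0) (Real.pi / 2) *
        modeRotation (Sum.inl 0) (Sum.inl 1) (Real.pi / 4)
      fromBlocks G 0 0 G := by
  simp [swapNetwork, beamSplitter, fromBlocks_multiply]

lemma sqrt_two_div_two_mul_self : √2 / 2 * (√2 / 2) = (1 / 2 : ℝ) := by
  nlinarith [Real.mul_self_sqrt (show (0 : ℝ) ≤ 2 by norm_num)]

/-- The first beam splitter undoes the mixing, the swap replaces the second mode by the vacuum, and
the last beam splitter mixes it with the first mode. -/
lemma passiveOutput_swapNetwork_one (p q r s : ℝ) :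
    passiveOutput (swapNetwork 1) (mixedProduct p q r s) = mixedProduct 1 p 1 r := by
  have h2 := sqrt_two_div_two_mul_self
  rw [swapNetwork_eq, mixedProduct, passiveOutput_fromBlocks
    (A := !![1 / 2, 1 / 2; -(1 / 2), -(1 / 2)]) (B := !![√2 / 2; √2 / 2])]
  · ext i j
    rcases i with i | i <;> rcases j with j | j <;> fin_cases i <;> fin_cases j <;>
      simp [mixedProduct, Matrix.mul_apply, Fin.sum_univ_two, -cons_mul, -cons_transpose] <;>
      linear_combination h2
  · ext i j
    rcases j with j | j <;> fin_cases i <;> fin_cases j <;>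
      simp [modeRotation, Matrix.mul_apply, Fin.sum_univ_two, Fintype.sum_sum_type, h2]

lemma passiveOutput_swapNetwork_zero (p q r s : ℝ) :
    passiveOutput (swapNetwork 0) (mixedProduct p q r s) = mixedProduct q 1 s 1 := by
  have h2 := sqrt_two_div_two_mul_self
  rw [swapNetwork_eq, mixedProduct, passiveOutput_fromBlocks
    (A := !![-(1 / 2), 1 / 2; -(1 / 2), 1 / 2]) (B := !![√2 / 2; -(√2 / 2)])]
  · ext i j
    rcases i with i | i <;> rcases j with j | j <;> fin_cases i <;> fin_cases j <;>
      simp [mixedProduct, Matrix.mul_apply, Fin.sum_univ_two, -cons_mul, -cons_transpose] <;>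
      first | linear_combination h2 | linear_combination -h2
  · ext i j
    rcases j with j | j <;> fin_cases i <;> fin_cases j <;>
      simp [modeRotation, Matrix.mul_apply, Fin.sum_univ_two, Fintype.sum_sum_type, h2]

lemma passiveOutput_one (V : QuadMatrix (Fin 2)) :
    passiveOutput (1 : QuadMatrix (Fin 2 ⊕ Fin 0)) V = V := by
  ext i j
  rcases i with i | i <;> rcases j with j | j <;>
    simp [passiveOutput, traceOut, addVacuum, toBlocks₁₁, toBlocks₁₂, toBlocks₂₁, toBlocks₂₂]

lemma isPassive_one : IsPassive (1 : QuadMatrix (Fin 2 ⊕ Fin 0)) := by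
  simp [IsPassive]

end SwapNetwork

/-! ### Symmetric states -/

section SymmetricStates

lemma sqrt_mins_sq {p r : ℝ} (hp : 0 < p) (hr : 0 < r) :
    min 1 (min √p √r) ^ 2 = min 1 (min p r) := by
  rw [← Real.sqrt_monotone.map_min, ← Real.sqrt_one, ← Real.sqrt_monotone.map_min,
    Real.sq_sqrt (le_min zero_le_one (lt_min hp hr).le), Real.sqrt_one]

/-- A symmetric state lies above a pure product state behind a balanced beam splitter with the
same squeezing below the vacuum level. -/
lemma exists_pure_mixedProduct_le {p q r s : ℝ} (hp : 0 < p) (hq : 0 < q) (hr : 0 < r)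
    (hs : 0 < s) (hpr : 1 ≤ p * r) (hqs : 1 ≤ q * s) :
    ∃ p' q' r' s', 0 < p' ∧ 0 < q' ∧ 0 < r' ∧ 0 < s' ∧ p' * r' = 1 ∧ q' * s' = 1 ∧
      (mixedProduct p q r s - mixedProduct p' q' r' s').PosSemidef ∧
      min p' r' * min q' s' = min 1 (min p r) * min 1 (min q s) := by
  obtain ⟨p', r', hp', hr', hpr', hpp, hrr, h1⟩ := exists_pure_variances hp hr hpr
  obtain ⟨q', s', hq', hs', hqs', hqq, hss, h2⟩ := exists_pure_variances hq hs hqs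
  refine ⟨p', q', r', s', hp', hq', hr', hs', hpr', hqs', ?_, by rw [h1, h2]⟩
  rw [mixedProduct_sub]
  exact posSemidef_mixedProduct (sub_nonneg.2 hpp) (sub_nonneg.2 hqq) (sub_nonneg.2 hrr)
    (sub_nonneg.2 hss)

/-- The bound on the two smallest eigenvalues of a pure state below a symmetric state is attained by
a pure product state behind the beam splitter. -/
lemma isLeast_squeezingValues {p q r s m : ℝ} (hp : 0 < p) (hq : 0 < q) (hr : 0 < r)
    (hs : 0 < s) (hpr : 1 ≤ p * r) (hqs : 1 ≤ q * s)
    (hm : m ^ 2 = min 1 (min p r) * min 1 (min q s)) :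
    IsLeast (squeezingValues (mixedProduct p q r s)) (-Real.log m) := by
  have hlog : -Real.log m = -(1 / 2) * Real.log (min 1 (min p r) * min 1 (min q s)) := by
    rw [← hm, Real.log_pow]
    push_cast
    ring
  rw [hlog]
  constructor
  · obtain ⟨p', q', r', s', hp', hq', hr', hs', hpr', hqs', hle, hmin⟩ :=
      exists_pure_mixedProduct_le hp hq hr hs hpr hqs
    have hP := isPure_mixedProduct hp' hq' hr' hs' hpr' hqs'
    refine ⟨_, mem_pureDecompositions hP hle, ?_⟩
    rw [pureSqueezing_eq hP, eigUp_mul_mixedProduct hp' hq' hr' hs' hpr' hqs', hmin]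
  · rintro _ ⟨P, hP, rfl⟩
    obtain ⟨h0, h1, -⟩ := eigUp_mul_le hP.1
    rw [pureSqueezing_eq hP.1]
    have := Real.log_le_log (mul_pos h0 h1) (eigUp_mul_le_of_mem hP)
    linarith

/-- No passive network produces more entanglement than the squeezing of formation allows. That the
output has a pure decomposition is recorded since `eof` is an infimum of real numbers, which is `0`
for the empty set. -/
lemma eof_passiveOutput_le {p q r s m : ℝ} (hp : 0 < p) (hq : 0 < q) (hr : 0 < r)
    (hs : 0 < s) (hpr : 1 ≤ p * r) (hqs : 1 ≤ q * s) (hm0 : 0 < m) (hm1 : m ≤ 1)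
    (hm : m ^ 2 = min 1 (min p r) * min 1 (min q s)) {n : ℕ}
    {K : QuadMatrix (Fin 2 ⊕ Fin n)} (hK : IsPassive K) :
    (pureDecompositions (passiveOutput K (mixedProduct p q r s))).Nonempty ∧
      eof (passiveOutput K (mixedProduct p q r s)) ≤ h m := by
  obtain ⟨p', q', r', s', hp', hq', hr', hs', hpr', hqs', hle, hmin⟩ :=
    exists_pure_mixedProduct_le hp hq hr hs hpr hqs
  have hbound : ∀ {x y : ℝ}, 0 < x → min p' r' ≤ x → min q' s' ≤ y → m ^ 2 ≤ x * y :=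
    fun hx h1 h2 => by
      rw [hm, ← hmin]
      exact mul_le_mul h1 h2 (lt_min hq' hs').le hx.le
  obtain ⟨P, hP, hdom⟩ := exists_mem_pureDecompositions_passiveOutput hp' hq' hr' hs' hpr' hqs'
    hle (pow_le_one₀ hm0.le hm1) (hbound hp' (min_le_left _ _) (min_le_left _ _))
    (hbound hp' (min_le_left _ _) (min_le_right _ _))
    (hbound hr' (min_le_right _ _) (min_le_left _ _))
    (hbound hr' (min_le_right _ _) (min_le_right _ _)) hK
  exact ⟨⟨P, hP⟩, eof_le hP hm0 hm1 hdom⟩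

/-- If `p s < 1`, the optimal pure component keeps the variances `p` and `s` of the two modes before
the beam splitter. Its partial transpose has a mode with variances `p` and `s`, whose symplectic
eigenvalue `√(p s)` is also the one found in the partial transpose of the mixed state. -/
lemma eof_mixedProduct_of_mul_lt_one {p q r s : ℝ} (hp : 0 < p) (hq : 0 < q) (hr : 0 < r)
    (hs : 0 < s) (hpr : 1 ≤ p * r) (hqs : 1 ≤ q * s) (hps : p * s < 1) :
    eof (mixedProduct p q r s) = h √(p * s) := by
  have h0 : 0 < p * s := mul_pos hp hs
  have hm : √(p * s) ^ 2 = p * s := Real.sq_sqrt h0.le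
  have hm0 : 0 < √(p * s) := Real.sqrt_pos.2 h0
  have hm1 : √(p * s) ≤ 1 := Real.sqrt_le_one.2 hps.le
  have hq' : 1 / s ≤ q := by rwa [div_le_iff₀ hs]
  have hr' : 1 / p ≤ r := by rwa [div_le_iff₀ hp, mul_comm]
  have hP : mixedProduct p (1 / s) (1 / p) s ∈ pureDecompositions (mixedProduct p q r s) := by
    refine mem_pureDecompositions (isPure_mixedProduct hp (by positivity) (by positivity) hs
      (mul_one_div_cancel hp.ne') (one_div_mul_cancel hs.ne')) ?_
    rw [mixedProduct_sub]
    exact posSemidef_mixedProduct (by simp) (sub_nonneg.2 hq') (sub_nonneg.2 hr') (by simp)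
  refine le_antisymm (eof_le hP hm0 hm1 ?_)
    (le_eof_mixedProduct (posDef_mixedProduct hp hq hr hs) ⟨_, hP⟩ hm0 hm1 (.inl hm.ge))
  rw [partialTranspose_mixedProduct]
  refine dominates_mixedProduct hp (by positivity) hs (by positivity) hm.le ?_
  rw [hm, one_div_mul_one_div, le_div_iff₀ (by positivity)]
  nlinarith

/-- The case where position is squeezed in the second and momentum in the first of the two modes
before the beam splitter. -/
lemma eof_mixedProduct_of_mul_lt_one' {p q r s : ℝ} (hp : 0 < p) (hq : 0 < q) (hr : 0 < r)
    (hs : 0 < s) (hpr : 1 ≤ p * r) (hqs : 1 ≤ q * s) (hqr : q * r < 1) :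
    eof (mixedProduct p q r s) = h √(q * r) := by
  have h0 : 0 < q * r := mul_pos hq hr
  have hm : √(q * r) ^ 2 = q * r := Real.sq_sqrt h0.le
  have hm0 : 0 < √(q * r) := Real.sqrt_pos.2 h0
  have hm1 : √(q * r) ≤ 1 := Real.sqrt_le_one.2 hqr.le
  have hp' : 1 / r ≤ p := by rwa [div_le_iff₀ hr]
  have hs' : 1 / q ≤ s := by rwa [div_le_iff₀ hq, mul_comm]
  have hP : mixedProduct (1 / r) q r (1 / q) ∈ pureDecompositions (mixedProduct p q r s) := by
    refine mem_pureDecompositions (isPure_mixedProduct (by positivity) hq hr (by positivity)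
      (one_div_mul_cancel hr.ne') (mul_one_div_cancel hq.ne')) ?_
    rw [mixedProduct_sub]
    exact posSemidef_mixedProduct (sub_nonneg.2 hp') (by simp) (by simp) (sub_nonneg.2 hs')
  refine le_antisymm (eof_le hP hm0 hm1 ?_)
    (le_eof_mixedProduct (posDef_mixedProduct hp hq hr hs) ⟨_, hP⟩ hm0 hm1 (.inr hm.ge))
  rw [partialTranspose_mixedProduct]
  refine dominates_mixedProduct (by positivity) hq (by positivity) hr ?_ hm.le
  rw [hm, one_div_mul_one_div, le_div_iff₀ (by positivity)]
  nlinarith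

lemma eof_mixedProduct_of_lt {p q r s : ℝ} (hp : 0 < p) (hq : 0 < q) (hr : 0 < r)
    (hs : 0 < s) (hpr : 1 ≤ p * r) (hqs : 1 ≤ q * s) (hlt : min p q * min r s < 1) :
    eof (mixedProduct p q r s) = h √(min p q * min r s) := by
  rcases le_total p q with h1 | h1 <;> rcases le_total r s with h2 | h2 <;>
    simp only [min_eq_left, min_eq_right, h1, h2] at hlt ⊢
  · linarith
  · exact eof_mixedProduct_of_mul_lt_one hp hq hr hs hpr hqs hlt
  · exact eof_mixedProduct_of_mul_lt_one' hp hq hr hs hpr hqs hlt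
  · linarith

/-- If the least position variance times the least momentum variance is at least `1`, the state
lies above a pure state with unentangled modes, both squeezed alike. -/
lemma eof_mixedProduct_eq_zero {p q r s : ℝ} (hr : 0 < r) (hs : 0 < s)
    (hge : 1 ≤ min p q * min r s) : eof (mixedProduct p q r s) = 0 := by
  set β := min r s with hβ
  have hβ0 : 0 < β := lt_min hr hs
  have h1 : 1 / β ≤ min p q := by rwa [div_le_iff₀ hβ0]
  have hP : mixedProduct (1 / β) (1 / β) β β ∈ pureDecompositions (mixedProduct p q r s) := by
    refine mem_pureDecompositions (isPure_mixedProduct (by positivity) (by positivity) hβ0 hβ0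
      (one_div_mul_cancel hβ0.ne') (one_div_mul_cancel hβ0.ne')) ?_
    rw [mixedProduct_sub]
    exact posSemidef_mixedProduct (sub_nonneg.2 (h1.trans (min_le_left _ _)))
      (sub_nonneg.2 (h1.trans (min_le_right _ _))) (sub_nonneg.2 (min_le_left _ _))
      (sub_nonneg.2 (min_le_right _ _))
  refine le_antisymm ?_ (eof_nonneg _)
  rw [← h_one]
  refine eof_le hP one_pos le_rfl ?_
  rw [partialTranspose_mixedProduct]
  have h2 : (1 : ℝ) ^ 2 ≤ 1 / β * β := by rw [one_div_mul_cancel hβ0.ne']; norm_num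
  exact dominates_mixedProduct (by positivity) (by positivity) hβ0 hβ0 h2 h2

/-- The two smallest eigenvalues of a symmetric state: its position and momentum blocks have the
same trace, so the least position and the least momentum variance are below the two others. -/
lemma eigUp_symmetric {p q r s : ℝ} (htr : p + q = r + s) :
    eigUp (mixedProduct p q r s) 0 = min (min p q) (min r s) ∧
      eigUp (mixedProduct p q r s) 1 = max (min p q) (min r s) := by
  have key : ∀ u v w x : ℝ, u ≤ v → v ≤ w → w ≤ x → [p, q, r, s].Perm [u, v, w, x] →
      eigUp (mixedProduct p q r s) 0 = u ∧ eigUp (mixedProduct p q r s) 1 = v := by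
    intro u v w x huv hvw hwx hperm
    have h2 : (mixedProduct p q r s).charpoly.roots = ([u, v, w, x] : List ℝ) := by
      rw [roots_charpoly_mixedProduct, Multiset.coe_eq_coe]
      exact hperm
    have h3 := eigUp_of_roots h2 (by
      simp [*, huv.trans hvw, (huv.trans hvw).trans hwx, hvw.trans hwx])
    rw [h3, h3]
    exact ⟨rfl, rfl⟩
  have perm : ∀ {l₁ l₂ : List ℝ}, (∀ a, l₁.count a = l₂.count a) → l₁.Perm l₂ :=
    fun h => List.perm_iff_count.2 h
  rcases le_total p q with h1 | h1 <;> rcases le_total r s with h2 | h2 <;>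
    simp only [min_eq_left, min_eq_right, h1, h2]
  · rcases le_total p r with h3 | h3
    · rw [min_eq_left h3, max_eq_right h3]
      exact key p r s q h3 h2 (by linarith) (perm fun a => by
        simp only [List.count_cons, List.count_nil]; ring)
    · rw [min_eq_right h3, max_eq_left h3]
      exact key r p q s h3 h1 (by linarith) (perm fun a => by
        simp only [List.count_cons, List.count_nil]; ring)
  · rcases le_total p s with h3 | h3
    · rw [min_eq_left h3, max_eq_right h3]
      exact key p s r q h3 h2 (by linarith) (perm fun a => by
        simp only [List.count_cons, List.count_nil]; ring)
    · rw [min_eq_right h3, max_eq_left h3]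
      exact key s p q r h3 h1 (by linarith) (perm fun a => by
        simp only [List.count_cons, List.count_nil]; ring)
  · rcases le_total q r with h3 | h3
    · rw [min_eq_left h3, max_eq_right h3]
      exact key q r s p h3 h2 (by linarith) (perm fun a => by
        simp only [List.count_cons, List.count_nil]; ring)
    · rw [min_eq_right h3, max_eq_left h3]
      exact key r q p s h3 h1 (by linarith) (perm fun a => by
        simp only [List.count_cons, List.count_nil]; ring)
  · rcases le_total q s with h3 | h3
    · rw [min_eq_left h3, max_eq_right h3]
      exact key q s r p h3 h2 (by linarith) (perm fun a => by
        simp only [List.count_cons, List.count_nil]; ring)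
    · rw [min_eq_right h3, max_eq_left h3]
      exact key s q p r h3 h1 (by linarith) (perm fun a => by
        simp only [List.count_cons, List.count_nil]; ring)

lemma squeezedProduct_of_one_le {p q r s : ℝ} (hp : 1 ≤ p) (hq : 1 ≤ q) (hr : 1 ≤ r)
    (hs : 1 ≤ s) : min 1 (min p r) * min 1 (min q s) = 1 := by
  rw [min_eq_left (le_min hp hr), min_eq_left (le_min hq hs), one_mul]

/-- If the least position and momentum variances are both at most `1`, then by the uncertainty
relation they belong to different modes, or are both equal to `1`. -/
lemma squeezedProduct_of_le_one {p q r s : ℝ} (hp : 0 < p) (hq : 0 < q) (hr : 0 < r)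
    (hs : 0 < s) (hpr : 1 ≤ p * r) (hqs : 1 ≤ q * s) (h1 : min p q ≤ 1) (h2 : min r s ≤ 1) :
    min 1 (min p r) * min 1 (min q s) = min p q * min r s := by
  have key : ∀ {x y : ℝ}, 0 < x → 1 ≤ x * y → x ≤ 1 → 1 ≤ y := fun hx hxy hx1 => by
    by_contra hy
    push Not at hy
    nlinarith
  rcases le_total p q with h3 | h3 <;> rcases le_total r s with h4 | h4 <;>
    simp only [min_eq_left, min_eq_right, h3, h4] at h1 h2 ⊢
  · have hr1 : r = 1 := le_antisymm h2 (key hp hpr h1)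
    have hp1 : p = 1 := le_antisymm h1 (key hr (by rwa [mul_comm]) h2)
    subst hr1 hp1
    simp [h3, h4]
  · have hr1 := key hp hpr h1
    have hq1 := key hs (by rwa [mul_comm]) h2
    rw [min_eq_left (h1.trans hr1), min_eq_right h1, min_eq_right (h2.trans hq1),
      min_eq_right h2]
  · have hs1 := key hq hqs h1
    have hp1 := key hr (by rwa [mul_comm]) h2
    rw [min_eq_right (h2.trans hp1), min_eq_right h2, min_eq_left (h1.trans hs1),
      min_eq_right h1, mul_comm]
  · have hs1 : s = 1 := le_antisymm h2 (key hq hqs h1)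
    have hq1 : q = 1 := le_antisymm h1 (key hs (by rwa [mul_comm]) h2)
    subst hs1 hq1
    simp [h3, h4]

/-- If the second smallest variance is at least `1`, only one mode is squeezed. -/
lemma squeezedProduct_of_lt_one {p q r s : ℝ} (htr : p + q = r + s)
    (h1 : min (min p q) (min r s) < 1) (h2 : 1 ≤ max (min p q) (min r s)) :
    min 1 (min p r) * min 1 (min q s) = min (min p q) (min r s) := by
  -- the blocks have equal traces, so the larger variance of the squeezed block exceeds `1`
  rcases le_max_iff.1 h2 with h3 | h3
  · have h5 : min r s < 1 := (min_lt_iff.1 h1).resolve_left (not_lt.2 h3)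
    rw [min_eq_right (h5.le.trans h3)]
    obtain ⟨hp1, hq1⟩ := le_min_iff.1 h3
    rcases le_total r s with h4 | h4
    · rw [min_eq_left h4] at h5 ⊢
      rw [min_eq_right (h5.le.trans hp1), min_eq_right h5.le,
        min_eq_left (le_min hq1 (by linarith)), mul_one]
    · rw [min_eq_right h4] at h5 ⊢
      rw [min_eq_right (h5.le.trans hq1), min_eq_right h5.le,
        min_eq_left (le_min hp1 (by linarith)), one_mul]
  · have h5 : min p q < 1 := (min_lt_iff.1 h1).resolve_right (not_lt.2 h3)
    rw [min_eq_left (h5.le.trans h3)]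
    obtain ⟨hr1, hs1⟩ := le_min_iff.1 h3
    rcases le_total p q with h4 | h4
    · rw [min_eq_left h4] at h5 ⊢
      rw [min_eq_left (h5.le.trans hr1), min_eq_right h5.le,
        min_eq_left (le_min (by linarith) hs1), mul_one]
    · rw [min_eq_right h4] at h5 ⊢
      rw [min_eq_left (h5.le.trans hs1), min_eq_right h5.le,
        min_eq_left (le_min (by linarith) hr1), one_mul]

/-- If exactly one variance is below `1`, the swap network that replaces the unsqueezed mode by
the vacuum attains the upper bound on the entanglement of formation. -/
lemma exists_eof_swapNetwork {p q r s m : ℝ} (hp : 0 < p) (hq : 0 < q) (hr : 0 < r)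
    (hs : 0 < s) (hpr : 1 ≤ p * r) (hqs : 1 ≤ q * s) (hm0 : 0 < m) (hm1 : m ≤ 1)
    (hm : m ^ 2 = min 1 (min p r) * min 1 (min q s))
    (htr : p + q = r + s) (h1 : min (min p q) (min r s) < 1) (h2 : 1 ≤ max (min p q) (min r s)) :
    (1 ≤ q ∧ 1 ≤ s ∧ eof (passiveOutput (swapNetwork 1) (mixedProduct p q r s)) = h m) ∨
      (1 ≤ p ∧ 1 ≤ r ∧ eof (passiveOutput (swapNetwork 0) (mixedProduct p q r s)) = h m) := by
  have key1 : p ≤ m ^ 2 ∨ r ≤ m ^ 2 →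
      eof (passiveOutput (swapNetwork 1) (mixedProduct p q r s)) = h m := by
    intro hle
    obtain ⟨hne, hub⟩ := eof_passiveOutput_le hp hq hr hs hpr hqs hm0 hm1 hm
      (isPassive_swapNetwork 1)
    refine le_antisymm hub ?_
    rw [passiveOutput_swapNetwork_one] at hne ⊢
    exact le_eof_mixedProduct (posDef_mixedProduct one_pos hp one_pos hr) hne hm0 hm1
      (by rw [one_mul, mul_one]; exact hle.symm)
  have key0 : q ≤ m ^ 2 ∨ s ≤ m ^ 2 →
      eof (passiveOutput (swapNetwork 0) (mixedProduct p q r s)) = h m := by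
    intro hle
    obtain ⟨hne, hub⟩ := eof_passiveOutput_le hp hq hr hs hpr hqs hm0 hm1 hm
      (isPassive_swapNetwork 0)
    refine le_antisymm hub ?_
    rw [passiveOutput_swapNetwork_zero] at hne ⊢
    exact le_eof_mixedProduct (posDef_mixedProduct hq one_pos hs one_pos) hne hm0 hm1
      (by rw [one_mul, mul_one]; exact hle)
  have hl : m ^ 2 = min (min p q) (min r s) := hm.trans (squeezedProduct_of_lt_one htr h1 h2)
  rcases le_max_iff.1 h2 with h3 | h3
  · have h5 : min r s < 1 := (min_lt_iff.1 h1).resolve_left (not_lt.2 h3)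
    rw [min_eq_right (h5.le.trans h3)] at hl
    obtain ⟨hp1, hq1⟩ := le_min_iff.1 h3
    rcases le_total r s with h4 | h4
    · rw [min_eq_left h4] at hl h5
      exact .inl ⟨hq1, by linarith, key1 (.inr hl.ge)⟩
    · rw [min_eq_right h4] at hl h5
      exact .inr ⟨hp1, by linarith, key0 (.inr hl.ge)⟩
  · have h5 : min p q < 1 := (min_lt_iff.1 h1).resolve_right (not_lt.2 h3)
    rw [min_eq_left (h5.le.trans h3)] at hl
    obtain ⟨hr1, hs1⟩ := le_min_iff.1 h3
    rcases le_total p q with h4 | h4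
    · rw [min_eq_left h4] at hl h5
      exact .inl ⟨by linarith, hs1, key1 (.inl hl.ge)⟩
    · rw [min_eq_right h4] at hl h5
      exact .inr ⟨by linarith, hr1, key0 (.inl hl.ge)⟩

end SymmetricStates

end GaussianEoF

end

open GaussianEoF in
theorem mainTheorem3 (a c₁ c₂ : ℝ) (σ : GaussianEoF.QuadMatrix (Fin 2))
    (hsym : σ = GaussianEoF.symmetricState a c₁ c₂) (hcov : GaussianEoF.IsCovariance σ)
    (m l₁ l₂ : ℝ)
    (hm : m = GaussianEoF.muPlus a c₁ c₂ * GaussianEoF.muMinus a c₁ c₂)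
    (hl₁ : l₁ = GaussianEoF.eigUp σ 0) (hl₂ : l₂ = GaussianEoF.eigUp σ 1) :
    -- squeezing of formation
    IsGLB (GaussianEoF.squeezingValues σ) (-Real.log m) ∧
    GaussianEoF.sof σ = -Real.log m ∧
    -- EoF-potential
    IsLUB (GaussianEoF.attainableEof σ) (GaussianEoF.h m) ∧
    GaussianEoF.eofPotential σ = GaussianEoF.h m ∧
    -- entanglement of formation, and when it equals the potential
    (l₁ * l₂ < 1 → GaussianEoF.eof σ = GaussianEoF.h (Real.sqrt (l₁ * l₂))) ∧
    (1 ≤ l₁ * l₂ → GaussianEoF.eof σ = 0) ∧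
    (1 ≤ l₁ ∨ l₂ ≤ 1 → GaussianEoF.eof σ = GaussianEoF.h m) ∧
    (l₁ < 1 → 1 < l₂ → GaussianEoF.eof σ < GaussianEoF.h m) ∧
    -- the network that attains the potential in the remaining case: the vacuum replaces the
    -- mode without squeezing (the second one, or the first one)
    (∀ k : Fin 2, GaussianEoF.IsPassive (GaussianEoF.swapNetwork k)) ∧
    (l₁ < 1 → 1 ≤ l₂ →
      (1 ≤ a - c₁ ∧ 1 ≤ a - c₂ ∧
        GaussianEoF.eof (GaussianEoF.passiveOutput (GaussianEoF.swapNetwork 1) σ) =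
          GaussianEoF.h m) ∨
      (1 ≤ a + c₁ ∧ 1 ≤ a + c₂ ∧
        GaussianEoF.eof (GaussianEoF.passiveOutput (GaussianEoF.swapNetwork 0) σ) =
          GaussianEoF.h m)) := by
  -- `p`, `r` and `q`, `s` are the position and momentum variances of the two modes of `σ` before
  -- the beam splitter, and the uncertainty relation reads `1 ≤ p r`, `1 ≤ q s`
  set p := a + c₁ with hp_def
  set q := a - c₁ with hq_def
  set r := a + c₂ with hr_def
  set s := a - c₂ with hs_def
  have htr : p + q = r + s := by rw [hp_def, hq_def, hr_def, hs_def]; ring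
  have hσ : σ = mixedProduct p q r s := hsym.trans (symmetricState_eq_mixedProduct a c₁ c₂)
  obtain ⟨hpd, hdom⟩ := isCovariance_iff.1 hcov
  rw [hσ] at hpd hdom
  obtain ⟨hp, hq, hr, hs⟩ := pos_of_posDef_mixedProduct hpd
  rw [← one_smul ℝ (symplecticForm (Fin 2))] at hdom
  obtain ⟨hpr, hqs⟩ := sq_le_of_dominates_mixedProduct hr hs hdom
  rw [one_pow] at hpr hqs
  have hm2 : m ^ 2 = min 1 (min p r) * min 1 (min q s) := by
    rw [hm, mul_pow, muPlus, muMinus, sqrt_mins_sq hp hr, sqrt_mins_sq hq hs]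
  have hmu0 : ∀ {x y : ℝ}, 0 < x → 0 < y → 0 < min 1 (min √x √y) := fun hx hy =>
    lt_min one_pos (lt_min (Real.sqrt_pos.2 hx) (Real.sqrt_pos.2 hy))
  have hm0 : 0 < m := hm ▸ mul_pos (hmu0 hp hr) (hmu0 hq hs)
  have hm1 : m ≤ 1 := hm ▸ mul_le_one₀ (min_le_left _ _) (hmu0 hq hs).le (min_le_left _ _)
  obtain ⟨he₁, he₂⟩ := eigUp_symmetric htr
  rw [hσ, he₁] at hl₁
  rw [hσ, he₂] at hl₂
  have hl : l₁ * l₂ = min p q * min r s := by rw [hl₁, hl₂, min_mul_max]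
  have hl₁0 : 0 < l₁ := hl₁ ▸ lt_min (lt_min hp hq) (lt_min hr hs)
  clear_value p q r s
  subst hσ
  have hlt : l₁ * l₂ < 1 → eof (mixedProduct p q r s) = h √(l₁ * l₂) := fun h1 => by
    rw [hl] at h1 ⊢
    exact eof_mixedProduct_of_lt hp hq hr hs hpr hqs h1
  have hge : 1 ≤ l₁ * l₂ → eof (mixedProduct p q r s) = 0 := fun h1 => by
    rw [hl] at h1
    exact eof_mixedProduct_eq_zero hr hs h1
  have heq : 1 ≤ l₁ ∨ l₂ ≤ 1 → eof (mixedProduct p q r s) = h m := by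
    rintro (h1 | h1)
    · rw [hl₁, le_min_iff, le_min_iff, le_min_iff] at h1
      obtain ⟨⟨hp1, hq1⟩, hr1, hs1⟩ := h1
      rw [squeezedProduct_of_one_le hp1 hq1 hr1 hs1] at hm2
      have : m = 1 := le_antisymm hm1 (by nlinarith)
      rw [this, h_one, hge]
      rw [hl]
      exact one_le_mul_of_one_le_of_one_le (le_min hp1 hq1) (le_min hr1 hs1)
    · rw [hl₂, max_le_iff] at h1
      rw [squeezedProduct_of_le_one hp hq hr hs hpr hqs h1.1 h1.2, ← hl] at hm2
      have hme : m = √(l₁ * l₂) := by rw [← hm2, Real.sqrt_sq hm0.le]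
      rcases lt_or_ge (l₁ * l₂) 1 with h2 | h2
      · rw [hme, hlt h2]
      · -- both eigenvalues are then equal to `1`
        have : m = 1 := le_antisymm hm1 (by nlinarith)
        rw [this, h_one, hge h2]
  have hswap : l₁ < 1 → 1 ≤ l₂ → _ := fun h1 h2 =>
    exists_eof_swapNetwork hp hq hr hs hpr hqs hm0 hm1 hm2 htr (hl₁ ▸ h1) (hl₂ ▸ h2)
  have hleast := isLeast_squeezingValues hp hq hr hs hpr hqs hm2
  have hgreatest : IsGreatest (attainableEof (mixedProduct p q r s)) (h m) := by
    constructor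
    · by_cases h1 : 1 ≤ l₁ ∨ l₂ ≤ 1
      · exact ⟨0, 1, isPassive_one, by rw [passiveOutput_one, heq h1]⟩
      · push Not at h1
        rcases hswap h1.1 h1.2.le with ⟨-, -, h2⟩ | ⟨-, -, h2⟩
        · exact ⟨1, _, isPassive_swapNetwork 1, h2.symm⟩
        · exact ⟨1, _, isPassive_swapNetwork 0, h2.symm⟩
    · rintro _ ⟨n, K, hK, rfl⟩
      exact (eof_passiveOutput_le hp hq hr hs hpr hqs hm0 hm1 hm2 hK).2
  refine ⟨hleast.isGLB, hleast.csInf_eq, hgreatest.isLUB, hgreatest.csSup_eq, hlt, hge, heq, ?_,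
    isPassive_swapNetwork, hswap⟩
  -- for `l₁ < 1 < l₂` the squeezing is `m² = l₁`, which lies strictly below `min 1 (l₁ l₂)`
  intro h1 h2
  rw [squeezedProduct_of_lt_one htr (hl₁ ▸ h1) (hl₂ ▸ h2.le), ← hl₁] at hm2
  rcases lt_or_ge (l₁ * l₂) 1 with h3 | h3
  · rw [hlt h3]
    have h4 : m < √(l₁ * l₂) := by
      rw [Real.lt_sqrt hm0.le, hm2]
      exact lt_mul_of_one_lt_right hl₁0 h2
    exact h_strictAntiOn ⟨hm0, hm1⟩ ⟨hm0.trans h4, Real.sqrt_le_one.2 h3.le⟩ h4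
  · rw [hge h3, ← h_one]
    have h4 : m < 1 := by nlinarith
    exact h_strictAntiOn ⟨hm0, hm1⟩ ⟨one_pos, le_rfl⟩ h4
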